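/- **Setting.** JSON values are $\mathrm{null}$, booleans, real numbers, strings, finite arrays, and finite objects (unordered sets of name-value members without repeated names). Patterns $r$ are regular expressions extended with a complement operator; $L(r)$ is the language of $r$. The schemas of the *closed algebra* are generated by the typed operators $\mathsf{len}_l^j$, $\mathsf{betw}_m^M$, $\mathsf{xBetw}_m^M$, $\mathsf{mulOf}(q)$, $\mathsf{notMulOf}(q)$ ($q>0$), $\mathsf{pattern}(r)$, $\mathsf{props}(r_1:S_1,\dots,r_n:S_n;S)$, $\mathsf{pro}_l^j$, $\mathsf{req}(k_1,\dots,k_n)$, $\mathsf{pNames}(S)$, $\mathsf{pattReq}(r_1:S_1,\dots,r_n:S_n)$, $\mathsf{items}(S_1,\dots,S_n;S)$, $\mathsf{contains}(S)$, $\mathsf{contAfter}(n:S)$, $\mathsf{ite}_l^j$, $\mathsf{uniqueItems}$, $\mathsf{repeatedItems}$, each of which accepts every instance that is not of its type (string, number, object, array, respectively), by $\mathsf{type}(T_1,\dots,T_{n+1})$, $\mathsf{const}(J)$, $\mathsf{enum}(J_1,\dots,J_{n+1})$, by variables $x$, and by the boolean operators $\mathbf t,\mathbf f,\neg,\vee,\wedge,\{S_1,\dots,S_n\},\Rightarrow,(S_1\Rightarrow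 S_2\mid S_3)$ and $\oplus$ (exactly one holds). Here $\mathsf{pattReq}(r_1:S_1,\dots)$ requires of an object, for each $i$, a member whose name matches $r_i$ and whose value satisfies $S_i$; $\mathsf{contAfter}(n:S)$ requires of an array an element satisfying $S$ in a position greater than $n$ (counting from $1$); $\mathsf{notMulOf}(q)$ and $\mathsf{repeatedItems}$ are the duals of $\mathsf{mulOf}(q)$ and $\mathsf{uniqueItems}$; the other operators have their JSON Schema (Draft-06) meaning. The *negation operators* are $\neg$, $\Rightarrow$, $(\cdot\Rightarrow\cdot\mid\cdot)$ and $\oplus$. A document $D=S\ \mathsf{defs}(E)$ consists of a schema $S$ and an environment $E=(x_1:S_1,\dots,x_n:S_n)$ with distinct $x_i$. Put $[\![x]\!]^0_E=\emptyset$, $[\![x]\!]^{i+1}_E=[\![E(x)]\!]^i_E$, interpret all other operators at index $i$ by their meaning, and let $[\![D]\!]=[\![S]\!]_E=\bigcup_i\bigcap_{j\ge i}[\![S]\!]^j_E$. The document is *well formed* if every variable occurring in $S,S_1,\dots,S_n$ is among $x_1,\dots,x_n$ and recursion is guarded: the relation "the definition of $x$ contains an occurrence of $y$ outside the scope of every typed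 operator" is acyclic. **Not-elimination.** Write $\mathsf{itemAt}(i:S)=\mathsf{items}(\mathbf t^{i-1},S;\mathbf t)$ and $\mathsf{itemsAfter}(n:S)=\mathsf{items}(\mathbf t^{n};S)$, where $\mathbf t^k$ is a sequence of $k$ copies of $\mathbf t$. Let $\bar r$ be the complement of $r$ and let $\underline{k}$ be the pattern matching exactly the string $k$. 1. *Simplification* rewrites, everywhere in $D$: - $\mathsf{items}(S_1,\dots,S_n;S)$ as $\bigwedge_i\mathsf{itemAt}(i:S_i)\wedge\mathsf{itemsAfter}(n:S)$, and $\mathsf{contains}(S)$ as $\mathsf{contAfter}(0:S)$; - $\mathsf{props}(r_1:S_1,\dots,r_n:S_n;S)$ as $\bigwedge_i\mathsf{props}(r_i:S_i;\mathbf t)\wedge\mathsf{props}(\overline{r_1|\dots|r_n}:S;\mathbf t)$; - $\mathsf{req}(k_1,\dots,k_n)$ as $\bigwedge_i\mathsf{pattReq}(\underline{k_i}:\mathbf t)$, and $n$-ary $\mathsf{pattReq}$ as a conjunction of unary ones; - $\mathsf{type}(T_1,\dots,T_{n})$ as $\bigvee_i\mathsf{type}(T_i)$, and $\mathsf{enum}(J_1,\dots,J_{n})$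 as $\bigvee_i\mathsf{const}(J_i)$; - $\mathsf{const}(J)$, for $J$ not a boolean: $\mathsf{const}(\mathrm{null})=\mathsf{type}(\mathsf{Null})$; $\mathsf{const}(m)=\mathsf{type}(\mathsf{Num})\wedge\mathsf{betw}_m^m$; $\mathsf{const}(s)=\mathsf{type}(\mathsf{Str})\wedge\mathsf{pattern}(\underline s)$; $\mathsf{const}([J_1,\dots,J_n])=\mathsf{type}(\mathsf{Arr})\wedge\mathsf{ite}_n^n\wedge\bigwedge_i\mathsf{itemAt}(i:\mathsf{const}(J_i))$; $\mathsf{const}(\{k_1:J_1,\dots,k_n:J_n\})=\mathsf{type}(\mathsf{Obj})\wedge\mathsf{req}(k_1,\dots,k_n)\wedge\mathsf{pro}_0^n\wedge\bigwedge_i\mathsf{props}(\underline{k_i}:\mathsf{const}(J_i);\mathbf t)$; - $\mathsf{pNames}(S)$ as $\mathsf{props}(r:\mathbf f;\mathbf t)$, where $r$ is a pattern of the strings that satisfy $\neg S$ in $E$, computed by recursion on the boolean structure of $\neg S$, expanding variables by their definitions; - $\Rightarrow$, $(\cdot\Rightarrow\cdot\mid\cdot)$, $\oplus$ and $\{\dots\}$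 according to their definitions through $\neg,\wedge,\vee$, and trivial bounds (such as $\mathsf{len}_0^\infty$) as $\mathbf t$. 2. *Not-completion* adds to the environment, for every definition $x:S_x$, a definition $not\_x:\neg S_x$, where the names $not\_x$ are distinct and different from all defined variables. Put $\overline{x}=not\_x$ and $\overline{not\_x}=x$. 3. *Not-pushing* pushes every negation, from the outside inwards, by the following rules: the standard rules for $\mathbf t,\mathbf f,\wedge,\vee,\neg\neg$; $\neg x=\overline x$; $\neg\mathsf{type}(T)=\bigvee_{T'\ne T}\mathsf{type}(T')$; $\neg\mathsf{const}(b)=\bigvee_{T\neq\mathsf{Bool}}\mathsf{type}(T)\vee\mathsf{const}(\text{not }b)$ for a boolean $b$; $\neg\mathsf{len}_i^j=\mathsf{type}(\mathsf{Str})\wedge(\mathsf{len}_0^{i-1}\vee\mathsf{len}_{j+1}^\infty)$, and in the same way for $\mathsf{pro}$ (with $\mathsf{Obj}$) and $\mathsf{ite}$ (with $\mathsf{Arr}$); $\neg\mathsf{betw}_m^M=\mathsf{type}(\mathsf{Num})\wedge(\mathsf{xBetw}_{-\infty}^m\vee\mathsf{xBetw}_M^\infty)$, and the same with $\mathsf{betw}$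 and $\mathsf{xBetw}$ exchanged (illegal bounds are dropped from these disjunctions); $\neg\mathsf{pattern}(r)=\mathsf{type}(\mathsf{Str})\wedge\mathsf{pattern}(\bar r)$; for the dual pairs $\mathsf{mulOf}(q)/\mathsf{notMulOf}(q)$, $\mathsf{uniqueItems}/\mathsf{repeatedItems}$, $\mathsf{itemsAfter}(n:S)/\mathsf{contAfter}(n:S)$, $\mathsf{props}(r:S;\mathbf t)/\mathsf{pattReq}(r:S)$, in both directions, the negation of one is the conjunction of the type it is about with the other, applied to $\neg S$ where there is an argument $S$; and $\neg\mathsf{itemAt}(i:S)=\mathsf{type}(\mathsf{Arr})\wedge\mathsf{itemAt}(i:\neg S)\wedge\mathsf{ite}_i^\infty$. **Statement.** Let $D=S\ \mathsf{defs}(E)$ be a well-formed document of the closed algebra, and let the names $not\_x$ be fresh as above. (a) The not-completion $S\ \mathsf{defs}(E^+)$ of $D$ is well formed and has the same semantics as $D$, and $[\![\neg x]\!]_E=[\![not\_x]\!]_{E^+}$ for every defined variable $x$. (b) Simplification, simplification followed by not-completion, and the whole not-elimination procedure each produce a document with the same semantics $[\![D]\!]$. (c) The result of not-elimination is a well-formed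 document of the closed algebra in which no negation operator occurs, neither in its schema nor in its environment. Hence, when the set of variable names is infinite, the closed algebra is negation-closed: for every well-formed document $D$, possibly with negated recursive variables, there is a well-formed document $D'$ of the closed algebra without negation operators such that $[\![D']\!]=[\![D]\!]$. -/

import Mathlib

/-- The six predefined JSON types. -/
inductive JType where
  | arr | obj | null | bool | str | num

/-- JSON values. An array is a finite sequence of values. An object is a finite set of names
together with a value for each name, so that names are not repeated and the order of the
members is immaterial. -/
inductive JSON where
  | null : JSON
  | bool (b : Bool) : JSON
  | num (x : ℝ) : JSON
  | str (s : String) : JSON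
  | arr (n : ℕ) (f : Fin n → JSON) : JSON
  | obj (ks : Finset String) (f : {k // k ∈ ks} → JSON) : JSON

/-- The type of a JSON value. -/
def JSON.typeOf : JSON → JType
  | .null => .null
  | .bool _ => .bool
  | .num _ => .num
  | .str _ => .str
  | .arr _ _ => .arr
  | .obj _ _ => .obj

/-- Regular expressions over characters, with a complement operator. -/
inductive Pattern where
  | empty : Pattern
  | eps : Pattern
  | char (c : Char) : Pattern
  | any : Pattern
  | alt (r r' : Pattern) : Pattern
  | seq (r r' : Pattern) : Pattern
  | star (r : Pattern) : Pattern
  | compl (r : Pattern) : Pattern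

namespace Pattern

/-- The language of a pattern. -/
def lang : Pattern → Language Char
  | empty => 0
  | eps => 1
  | char c => {[c]}
  | any => {w | w.length = 1}
  | alt r r' => r.lang + r'.lang
  | seq r r' => r.lang * r'.lang
  | star r => KStar.kstar r.lang
  | compl r => {w | w ∉ r.lang}

/-- The string `s` matches the pattern `r`. -/
def Matches (r : Pattern) (s : String) : Prop := s.toList ∈ r.lang

/-- The pattern that matches every string. -/
def univ : Pattern := star any

/-- The pattern that matches no string. -/
def none : Pattern := compl univ

/-- The pattern that matches exactly the strings matched by both arguments. -/
def inter (r r' : Pattern) : Pattern := compl (alt (compl r) (compl r'))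

/-- The pattern that matches exactly the string `s`. -/
def exact (s : String) : Pattern := s.toList.foldr (fun c r => seq (char c) r) eps

/-- `r₁ | … | rₙ` -/
def altList (l : List Pattern) : Pattern := l.foldr alt empty

/-- The intersection of the listed patterns. -/
def interList (l : List Pattern) : Pattern := l.foldr inter univ

/-- The strings of length exactly `n`. -/
def anyPow : ℕ → Pattern
  | 0 => eps
  | n + 1 => seq any (anyPow n)

/-- The strings whose length is between `l` and `j`. -/
def lenBetween (l : ℕ) (j : ℕ∞) : Pattern :=
  if j = ⊤ then seq (anyPow l) univ
  else altList (((List.range (j.toNat + 1)).filter (l ≤ ·)).map anyPow)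

end Pattern

/-- Schemas of the closed algebra, with variables in `V`. A family indexed by `Fin (n + 1)` is a
list that is not empty. -/
inductive Schema (V : Type*) where
  | type (n : ℕ) (T : Fin (n + 1) → JType) : Schema V
  | const (J : JSON) : Schema V
  | enum (n : ℕ) (J : Fin (n + 1) → JSON) : Schema V
  | len (l : ℕ) (j : ℕ∞) : Schema V
  | betw (m : WithBot ℝ) (M : WithTop ℝ) : Schema V
  | xBetw (m : WithBot ℝ) (M : WithTop ℝ) : Schema V
  | mulOf (q : {q : ℝ // 0 < q}) : Schema V
  | pattern (r : Pattern) : Schema V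
  /-- `props (r₁ : S₁, …, rₙ : Sₙ; A)` -/
  | props (n : ℕ) (r : Fin n → Pattern) (S : Fin n → Schema V) (A : Schema V) : Schema V
  | pro (l : ℕ) (j : ℕ∞) : Schema V
  | req (n : ℕ) (k : Fin n → String) : Schema V
  | pNames (S : Schema V) : Schema V
  /-- `items (S₁, …, Sₙ; A)` -/
  | items (n : ℕ) (S : Fin n → Schema V) (A : Schema V) : Schema V
  | contains (S : Schema V) : Schema V
  | ite (l : ℕ) (j : ℕ∞) : Schema V
  | uniqueItems : Schema V
  | var (x : V) : Schema V
  | tt : Schema V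
  | ff : Schema V
  | neg (S : Schema V) : Schema V
  | or (S₁ S₂ : Schema V) : Schema V
  /-- `⊕ (S₁, …, Sₙ₊₁)`: exactly one of the arguments holds. -/
  | oneOf (n : ℕ) (S : Fin (n + 1) → Schema V) : Schema V
  | imp (S₁ S₂ : Schema V) : Schema V
  /-- `(S₁ ⇒ S₂ | S₃)`: if `S₁` then `S₂` else `S₃`. -/
  | cond (S₁ S₂ S₃ : Schema V) : Schema V
  | and (S₁ S₂ : Schema V) : Schema V
  /-- `{S₁, …, Sₙ}` -/
  | all (n : ℕ) (S : Fin n → Schema V) : Schema V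
  | notMulOf (q : {q : ℝ // 0 < q}) : Schema V
  | repeatedItems : Schema V
  /-- `pattReq (r₁ : S₁, …, rₙ : Sₙ)` -/
  | pattReq (n : ℕ) (r : Fin n → Pattern) (S : Fin n → Schema V) : Schema V
  /-- `contAfter (n : S)` -/
  | contAfter (n : ℕ) (S : Schema V) : Schema V

/-- A document `S defs (x₁ : S₁, …, xₙ : Sₙ)`, for schemas taken from `σ`. -/
structure Doc (V σ : Type*) where
  root : σ
  env : List (V × σ)

/-- Documents of the closed algebra. -/
abbrev Document (V : Type*) := Doc V (Schema V)

/-- The variables that are defined in the document. -/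
def Doc.names {V σ : Type*} (D : Doc V σ) : List V := D.env.map Prod.fst

/-- Apply a transformation to the root and to the body of every definition. -/
def Doc.mapBodies {V σ τ : Type*} (f : σ → τ) (D : Doc V σ) : Doc V τ :=
  ⟨f D.root, D.env.map fun p => (p.1, f p.2)⟩

namespace Schema

variable {V : Type*}

/-- One layer of the semantics: the instances that satisfy a schema, when the variables are
interpreted by `ρ`. Positions in arrays are counted from `0` here. -/
def eval (ρ : V → Set JSON) : Schema V → Set JSON
  | type _ T => {J | ∃ i, J.typeOf = T i}
  | const J₀ => {J | J = J₀}
  | enum _ J₀ => {J | ∃ i, J = J₀ i}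
  | len l j => {J | match J with
      | .str s => l ≤ s.length ∧ (s.length : ℕ∞) ≤ j
      | _ => True}
  | betw m M => {J | match J with
      | .num x => m ≤ (x : WithBot ℝ) ∧ (x : WithTop ℝ) ≤ M
      | _ => True}
  | xBetw m M => {J | match J with
      | .num x => m < (x : WithBot ℝ) ∧ (x : WithTop ℝ) < M
      | _ => True}
  | mulOf q => {J | match J with
      | .num x => ∃ k : ℤ, x = k * q.1
      | _ => True}
  | pattern r => {J | match J with
      | .str s => r.Matches s
      | _ => True}
  | props n r S A => {J | match J with
      | .obj _ f => ∀ k, (∀ j : Fin n, (r j).Matches k.1 → f k ∈ (S j).eval ρ) ∧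
          ((∀ j : Fin n, ¬ (r j).Matches k.1) → f k ∈ A.eval ρ)
      | _ => True}
  | pro l j => {J | match J with
      | .obj ks _ => l ≤ ks.card ∧ (ks.card : ℕ∞) ≤ j
      | _ => True}
  | req _ k => {J | match J with
      | .obj ks _ => ∀ i, k i ∈ ks
      | _ => True}
  | pNames S => {J | match J with
      | .obj ks _ => ∀ k ∈ ks, JSON.str k ∈ S.eval ρ
      | _ => True}
  | items n S A => {J | match J with
      | .arr m f => ∀ l : Fin m, (∀ j : Fin n, l.1 = j.1 → f l ∈ (S j).eval ρ) ∧
          (n ≤ l.1 → f l ∈ A.eval ρ)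
      | _ => True}
  | contains S => {J | match J with
      | .arr _ f => ∃ l, f l ∈ S.eval ρ
      | _ => True}
  | ite l j => {J | match J with
      | .arr n _ => l ≤ n ∧ (n : ℕ∞) ≤ j
      | _ => True}
  | uniqueItems => {J | match J with
      | .arr _ f => ∀ i j, i ≠ j → f i ≠ f j
      | _ => True}
  | var x => ρ x
  | tt => Set.univ
  | ff => ∅
  | neg S => (S.eval ρ)ᶜ
  | or S₁ S₂ => S₁.eval ρ ∪ S₂.eval ρ
  | oneOf _ S => {J | ∃ l, J ∈ (S l).eval ρ ∧ ∀ k, k ≠ l → J ∉ (S k).eval ρ}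
  | imp S₁ S₂ => (S₁.eval ρ)ᶜ ∪ S₂.eval ρ
  | cond S₁ S₂ S₃ => (S₁.eval ρ ∩ S₂.eval ρ) ∪ ((S₁.eval ρ)ᶜ ∩ S₃.eval ρ)
  | and S₁ S₂ => S₁.eval ρ ∩ S₂.eval ρ
  | all _ S => ⋂ i, (S i).eval ρ
  | notMulOf q => {J | match J with
      | .num x => ¬ ∃ k : ℤ, x = k * q.1
      | _ => True}
  | repeatedItems => {J | match J with
      | .arr _ f => ∃ i j, i ≠ j ∧ f i = f j
      | _ => True}
  | pattReq n r S => {J | match J with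
      | .obj _ f => ∀ i : Fin n, ∃ k, (r i).Matches k.1 ∧ f k ∈ (S i).eval ρ
      | _ => True}
  | contAfter n S => {J | match J with
      | .arr m f => ∃ l : Fin m, n ≤ l.1 ∧ f l ∈ S.eval ρ
      | _ => True}

/-- The interpretation of index `i`, inductive on the lexicographic pair of `i` and the schema:
a variable denotes `∅` at index `0`, and at index `i + 1` it denotes the interpretation of its
definition at index `i`. -/
def semAt [DecidableEq V] (E : List (V × Schema V)) : ℕ → Schema V → Set JSON
  | 0, S => S.eval fun _ => ∅
  | i + 1, S => S.eval fun x =>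
      match E.lookup x with
      | some T => semAt E i T
      | none => ∅

/-- The semantics of a schema in an environment: the exists-forall limit of the interpretations
of index `i`. -/
def sem [DecidableEq V] (S : Schema V) (E : List (V × Schema V)) : Set JSON :=
  ⋃ i : ℕ, ⋂ j : ℕ, ⋂ _ : i ≤ j, semAt E j S

/-- The variables that occur in a schema. -/
def vars : Schema V → Set V
  | props _ _ S A => (⋃ i, (S i).vars) ∪ A.vars
  | pNames S => S.vars
  | items _ S A => (⋃ i, (S i).vars) ∪ A.vars
  | contains S => S.vars
  | var x => {x}
  | neg S => S.vars
  | or S₁ S₂ => S₁.vars ∪ S₂.vars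
  | oneOf _ S => ⋃ i, (S i).vars
  | imp S₁ S₂ => S₁.vars ∪ S₂.vars
  | cond S₁ S₂ S₃ => S₁.vars ∪ S₂.vars ∪ S₃.vars
  | and S₁ S₂ => S₁.vars ∪ S₂.vars
  | all _ S => ⋃ i, (S i).vars
  | pattReq _ _ S => ⋃ i, (S i).vars
  | contAfter _ S => S.vars
  | _ => ∅

/-- The variables that have an occurrence outside the scope of every typed operator. -/
def unguarded : Schema V → Set V
  | var x => {x}
  | neg S => S.unguarded
  | or S₁ S₂ => S₁.unguarded ∪ S₂.unguarded
  | oneOf _ S => ⋃ i, (S i).unguarded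
  | imp S₁ S₂ => S₁.unguarded ∪ S₂.unguarded
  | cond S₁ S₂ S₃ => S₁.unguarded ∪ S₂.unguarded ∪ S₃.unguarded
  | and S₁ S₂ => S₁.unguarded ∪ S₂.unguarded
  | all _ S => ⋃ i, (S i).unguarded
  | _ => ∅

/-- No negation operator occurs in the schema. The operators `⇒`, `(⇒ |)` and `⊕` count as
negation operators, since each of them can express negation. -/
def NegFree : Schema V → Prop
  | props _ _ S A => (∀ i, (S i).NegFree) ∧ A.NegFree
  | pNames S => S.NegFree
  | items _ S A => (∀ i, (S i).NegFree) ∧ A.NegFree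
  | contains S => S.NegFree
  | neg _ => False
  | or S₁ S₂ => S₁.NegFree ∧ S₂.NegFree
  | oneOf _ _ => False
  | imp _ _ => False
  | cond _ _ _ => False
  | and S₁ S₂ => S₁.NegFree ∧ S₂.NegFree
  | all _ S => ∀ i, (S i).NegFree
  | pattReq _ _ S => ∀ i, (S i).NegFree
  | contAfter _ S => S.NegFree
  | _ => True

end Schema

namespace Document

variable {V : Type*}

/-- The set of instances that satisfy the document. -/
def sem [DecidableEq V] (D : Document V) : Set JSON := D.root.sem D.env

/-- `x` unguardedly depends on `y`: the definition of `x` contains an unguarded occurrence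
of `y`. -/
def Depends [DecidableEq V] (D : Document V) (x y : V) : Prop :=
  ∃ S, D.env.lookup x = some S ∧ y ∈ S.unguarded

/-- Recursion is guarded: unguarded dependency is acyclic. -/
def Guarded [DecidableEq V] (D : Document V) : Prop :=
  ∀ x, ¬ Relation.TransGen D.Depends x x

/-- Every variable that is used, in the root or in a definition, is defined. -/
def Closing (D : Document V) : Prop :=
  (∀ x ∈ D.root.vars, x ∈ D.names) ∧ ∀ p ∈ D.env, ∀ x ∈ p.2.vars, x ∈ D.names

/-- No variable is defined twice, every variable is defined, and recursion is guarded. -/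
def WellFormed [DecidableEq V] (D : Document V) : Prop :=
  D.names.Nodup ∧ D.Closing ∧ D.Guarded

/-- No negation operator occurs in the document. -/
def NegFree (D : Document V) : Prop :=
  D.root.NegFree ∧ ∀ p ∈ D.env, p.2.NegFree

end Document

/-- Simplified schemas: the shape that simplification produces. -/
inductive Simple (V : Type*) where
  | type (T : JType) : Simple V
  /-- `const (true)` and `const (false)` -/
  | bool (b : Bool) : Simple V
  | len (l : ℕ) (j : ℕ∞) : Simple V
  | betw (m : WithBot ℝ) (M : WithTop ℝ) : Simple V
  | xBetw (m : WithBot ℝ) (M : WithTop ℝ) : Simple V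
  | mulOf (q : {q : ℝ // 0 < q}) : Simple V
  | notMulOf (q : {q : ℝ // 0 < q}) : Simple V
  | pattern (r : Pattern) : Simple V
  /-- `props (r : S; t)` -/
  | props (r : Pattern) (S : Simple V) : Simple V
  /-- `pattReq (r : S)` -/
  | pattReq (r : Pattern) (S : Simple V) : Simple V
  | pro (l : ℕ) (j : ℕ∞) : Simple V
  /-- `itemAt i S` constrains the element with index `i`, that is, in position `i + 1`: it stands
  for `items (t, …, t, S; t)`, with `i` copies of `t` before `S`. -/
  | itemAt (i : ℕ) (S : Simple V) : Simple V
  /-- `itemsAfter n S` stands for `items (t, …, t; S)`, with `n` copies of `t` before `S`. -/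
  | itemsAfter (n : ℕ) (S : Simple V) : Simple V
  | contAfter (n : ℕ) (S : Simple V) : Simple V
  | ite (l : ℕ) (j : ℕ∞) : Simple V
  | uniqueItems : Simple V
  | repeatedItems : Simple V
  | var (x : V) : Simple V
  | tt : Simple V
  | ff : Simple V
  | neg (S : Simple V) : Simple V
  | and (S₁ S₂ : Simple V) : Simple V
  | or (S₁ S₂ : Simple V) : Simple V

namespace Simple

variable {V : Type*}

/-- A simplified schema as a schema of the closed algebra. -/
def toSchema : Simple V → Schema V
  | type T => .type 0 fun _ => T
  | bool b => .const (.bool b)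
  | len l j => .len l j
  | betw m M => .betw m M
  | xBetw m M => .xBetw m M
  | mulOf q => .mulOf q
  | notMulOf q => .notMulOf q
  | pattern r => .pattern r
  | props r S => .props 1 (fun _ => r) (fun _ => S.toSchema) .tt
  | pattReq r S => .pattReq 1 (fun _ => r) (fun _ => S.toSchema)
  | pro l j => .pro l j
  | itemAt i S => .items (i + 1) (fun k => if k = Fin.last i then S.toSchema else .tt) .tt
  | itemsAfter n S => .items n (fun _ => .tt) S.toSchema
  | contAfter n S => .contAfter n S.toSchema
  | ite l j => .ite l j
  | uniqueItems => .uniqueItems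
  | repeatedItems => .repeatedItems
  | var x => .var x
  | tt => .tt
  | ff => .ff
  | neg S => .neg S.toSchema
  | and S₁ S₂ => .and S₁.toSchema S₂.toSchema
  | or S₁ S₂ => .or S₁.toSchema S₂.toSchema

/-- `S₁ ∧ … ∧ Sₙ` -/
def bigAnd : List (Simple V) → Simple V
  | [] => tt
  | [S] => S
  | S :: l => and S (bigAnd l)

/-- `S₁ ∨ … ∨ Sₙ` -/
def bigOr : List (Simple V) → Simple V
  | [] => ff
  | [S] => S
  | S :: l => or S (bigOr l)

/-- A trivial bound, from `0` to `∞`, is rewritten as `t`. -/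
def bound (op : ℕ → ℕ∞ → Simple V) (l : ℕ) (j : ℕ∞) : Simple V :=
  if l = 0 ∧ j = ⊤ then tt else op l j

open Classical in
/-- As `bound`, for an interval of numbers, from `-∞` to `∞`. -/
noncomputable def realBound (op : WithBot ℝ → WithTop ℝ → Simple V) (m : WithBot ℝ)
    (M : WithTop ℝ) : Simple V :=
  if m = ⊥ ∧ M = ⊤ then tt else op m M

/-- Elimination of `const`. -/
noncomputable def ofConst : JSON → Simple V
  | .null => type .null
  | .bool b => bool b
  | .num x => and (type .num) (betw x x)
  | .str s => and (type .str) (pattern (.exact s))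
  | .arr n f => bigAnd ([type .arr, ite n n] ++ List.ofFn fun i => itemAt i.1 (ofConst (f i)))
  | .obj ks f => bigAnd ([type .obj] ++
      ks.toList.map (fun k => pattReq (.exact k) tt) ++ [pro 0 ks.card] ++
      ks.attach.toList.map fun k => props (.exact k.1) (ofConst (f k)))

end Simple

namespace Schema

variable {V : Type*}

/-- The pattern of the strings that satisfy a schema, when `ρ` gives such a pattern for every
variable. Arguments of typed operators are not analyzed, because the typed operators that are not
about strings hold for every string. -/
noncomputable def pattOf (ρ : V → Pattern) : Schema V → Pattern
  | type n T => .altList (List.ofFn fun i : Fin (n + 1) =>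
      match T i with
      | .str => .univ
      | _ => .none)
  | const J => match J with
      | .str s => .exact s
      | _ => .none
  | enum n J => .altList (List.ofFn fun i : Fin (n + 1) =>
      match J i with
      | .str s => .exact s
      | _ => .none)
  | len l j => .lenBetween l j
  | pattern r => r
  | var x => ρ x
  | tt => .univ
  | ff => .none
  | neg S => .compl (S.pattOf ρ)
  | or S₁ S₂ => .alt (S₁.pattOf ρ) (S₂.pattOf ρ)
  | oneOf n S => .altList (List.ofFn fun l : Fin (n + 1) =>
      .interList (List.ofFn fun k : Fin (n + 1) =>
        if k = l then (S k).pattOf ρ else .compl ((S k).pattOf ρ)))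
  | imp S₁ S₂ => .alt (.compl (S₁.pattOf ρ)) (S₂.pattOf ρ)
  | cond S₁ S₂ S₃ => .alt (.inter (S₁.pattOf ρ) (S₂.pattOf ρ))
      (.inter (.compl (S₁.pattOf ρ)) (S₃.pattOf ρ))
  | and S₁ S₂ => .inter (S₁.pattOf ρ) (S₂.pattOf ρ)
  | all _ S => .interList (List.ofFn fun i => (S i).pattOf ρ)
  | _ => .univ

/-- The pattern of a variable, obtained by expanding definitions at nesting depth at most `d`. -/
noncomputable def pattVar [DecidableEq V] (E : List (V × Schema V)) : ℕ → V → Pattern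
  | 0, _ => .none
  | d + 1, x =>
      match E.lookup x with
      | some S => S.pattOf (pattVar E d)
      | none => .none

/-- The pattern of the strings that satisfy a schema in the environment `E`. With guarded
recursion, the nesting depth of the expansions never exceeds the number of definitions. -/
noncomputable def pattIn [DecidableEq V] (E : List (V × Schema V)) (S : Schema V) : Pattern :=
  S.pattOf (pattVar E E.length)

/-- Simplification of a schema in the environment `E`. -/
noncomputable def simplify [DecidableEq V] (E : List (V × Schema V)) : Schema V → Simple V
  | type _ T => .bigOr (List.ofFn fun i => .type (T i))
  | const J => .ofConst J
  | enum _ J => .bigOr (List.ofFn fun i => .ofConst (J i))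
  | len l j => .bound .len l j
  | betw m M => .realBound .betw m M
  | xBetw m M => .realBound .xBetw m M
  | mulOf q => .mulOf q
  | pattern r => .pattern r
  | props _ r S A => .bigAnd ((List.ofFn fun i => .props (r i) ((S i).simplify E)) ++
      [.props (.compl (.altList (List.ofFn r))) (A.simplify E)])
  | pro l j => .bound .pro l j
  | req _ k => .bigAnd (List.ofFn fun i => .pattReq (.exact (k i)) .tt)
  | pNames S => .props (pattIn E (.neg S)) .ff
  | items n S A => .bigAnd ((List.ofFn fun i : Fin n => .itemAt i.1 ((S i).simplify E)) ++
      [.itemsAfter n (A.simplify E)])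
  | contains S => .contAfter 0 (S.simplify E)
  | ite l j => .bound .ite l j
  | uniqueItems => .uniqueItems
  | var x => .var x
  | tt => .tt
  | ff => .ff
  | neg S => .neg (S.simplify E)
  | or S₁ S₂ => .or (S₁.simplify E) (S₂.simplify E)
  | oneOf n S => .bigOr (List.ofFn fun l : Fin (n + 1) =>
      .bigAnd (List.ofFn fun k : Fin (n + 1) =>
        if k = l then (S k).simplify E else .neg ((S k).simplify E)))
  | imp S₁ S₂ => .or (.neg (S₁.simplify E)) (S₂.simplify E)
  | cond S₁ S₂ S₃ => .or (.and (S₁.simplify E) (S₂.simplify E))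
      (.and (.neg (S₁.simplify E)) (S₃.simplify E))
  | and S₁ S₂ => .and (S₁.simplify E) (S₂.simplify E)
  | all _ S => .bigAnd (List.ofFn fun i => (S i).simplify E)
  | notMulOf q => .notMulOf q
  | repeatedItems => .repeatedItems
  | pattReq _ r S => .bigAnd (List.ofFn fun i => .pattReq (r i) ((S i).simplify E))
  | contAfter n S => .contAfter n (S.simplify E)

end Schema

namespace Simple

variable {V : Type*}

/-- The disjunction of the types different from a given one. -/
def otherTypes : JType → Simple V
  | .arr => bigOr [type .obj, type .null, type .bool, type .str, type .num]
  | .obj => bigOr [type .arr, type .null, type .bool, type .str, type .num]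
  | .null => bigOr [type .arr, type .obj, type .bool, type .str, type .num]
  | .bool => bigOr [type .arr, type .obj, type .null, type .str, type .num]
  | .str => bigOr [type .arr, type .obj, type .null, type .bool, type .num]
  | .num => bigOr [type .arr, type .obj, type .null, type .bool, type .str]

/-- `op 0 (l - 1) ∨ op (j + 1) ∞`, from which the illegal bounds are eliminated. -/
def outside (op : ℕ → ℕ∞ → Simple V) (l : ℕ) (j : ℕ∞) : Simple V :=
  bigOr ((if l = 0 then [] else [op 0 (l - 1 : ℕ)]) ++
    (if j = ⊤ then [] else [op (j.toNat + 1) ⊤]))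

/-- `op (-∞) m ∨ op M ∞`, from which the illegal bounds are eliminated. -/
noncomputable def realOutside (op : WithBot ℝ → WithTop ℝ → Simple V) (m : WithBot ℝ)
    (M : WithTop ℝ) : Simple V :=
  bigOr (WithBot.recBotCoe (C := fun _ : WithBot ℝ => List (Simple V)) [] (fun m : ℝ => [op ⊥ m]) m ++
    WithTop.recTopCoe (C := fun _ : WithTop ℝ => List (Simple V)) [] (fun M : ℝ => [op M ⊤]) M)

mutual

/-- Not-pushing: the result of pushing down every negation in a schema, where `co x` is the
complement variable of `x`. -/
noncomputable def push (co : V → V) : Simple V → Simple V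
  | neg S => pushNeg co S
  | and S₁ S₂ => and (push co S₁) (push co S₂)
  | or S₁ S₂ => or (push co S₁) (push co S₂)
  | props r S => props r (push co S)
  | pattReq r S => pattReq r (push co S)
  | itemAt i S => itemAt i (push co S)
  | itemsAfter n S => itemsAfter n (push co S)
  | contAfter n S => contAfter n (push co S)
  | type T => type T
  | bool b => bool b
  | len l j => len l j
  | betw m M => betw m M
  | xBetw m M => xBetw m M
  | mulOf q => mulOf q
  | notMulOf q => notMulOf q
  | pattern r => pattern r
  | pro l j => pro l j
  | ite l j => ite l j
  | uniqueItems => uniqueItems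
  | repeatedItems => repeatedItems
  | var x => var x
  | tt => tt
  | ff => ff

/-- The result of pushing down the negation of a schema, by the not-pushing rule for its outermost
operator. -/
noncomputable def pushNeg (co : V → V) : Simple V → Simple V
  | tt => ff
  | ff => tt
  | and S₁ S₂ => or (pushNeg co S₁) (pushNeg co S₂)
  | or S₁ S₂ => and (pushNeg co S₁) (pushNeg co S₂)
  | neg S => push co S
  | type T => otherTypes T
  | bool b => or (otherTypes .bool) (bool !b)
  | len l j => and (type .str) (outside len l j)
  | pattern r => and (type .str) (pattern (.compl r))
  | betw m M => and (type .num) (realOutside xBetw m M)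
  | xBetw m M => and (type .num) (realOutside betw m M)
  | mulOf q => and (type .num) (notMulOf q)
  | notMulOf q => and (type .num) (mulOf q)
  | ite l j => and (type .arr) (outside ite l j)
  | uniqueItems => and (type .arr) repeatedItems
  | repeatedItems => and (type .arr) uniqueItems
  | itemAt i S => bigAnd [type .arr, itemAt i (pushNeg co S), ite (i + 1) ⊤]
  | itemsAfter n S => and (type .arr) (contAfter n (pushNeg co S))
  | contAfter n S => and (type .arr) (itemsAfter n (pushNeg co S))
  | pro l j => and (type .obj) (outside pro l j)
  | props r S => and (type .obj) (pattReq r (pushNeg co S))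
  | pattReq r S => and (type .obj) (props r (pushNeg co S))
  | var x => var (co x)

end

end Simple

namespace Doc

variable {V σ : Type*}

/-- `not_` gives fresh and distinct names to the complement variables of the variables defined in
the document. -/
def Fresh (D : Doc V σ) (not_ : V → V) : Prop :=
  (∀ x ∈ D.names, ∀ y ∈ D.names, not_ x = not_ y → x = y) ∧ ∀ x ∈ D.names, not_ x ∉ D.names

/-- Not-completion: for every definition `x : S`, add the definition `not_ x : ¬ S`. -/
def notCompletion (neg : σ → σ) (not_ : V → V) (D : Doc V σ) : Doc V σ :=
  ⟨D.root, D.env ++ D.env.map fun p => (not_ p.1, neg p.2)⟩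

/-- The complement variable in the not-completion of a document that defines the variables `xs`:
the complement of `x` is `not_ x`, and the complement of `not_ x` is `x`. -/
def complement [DecidableEq V] (not_ : V → V) (xs : List V) (x : V) : V :=
  match xs.find? fun y => not_ y = x with
  | some y => y
  | none => not_ x

end Doc

/-- Not-completion of a document of the closed algebra. -/
def Document.notCompletion {V : Type*} (not_ : V → V) (D : Document V) : Document V :=
  Doc.notCompletion .neg not_ D

/-- The simplification phase. -/
noncomputable def Document.simplify {V : Type*} [DecidableEq V] (D : Document V) :
    Doc V (Simple V) :=
  D.mapBodies (Schema.simplify D.env)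

/-- The not-pushing phase, on the not-completion of a document that defines `xs`. -/
noncomputable def Doc.push {V : Type*} [DecidableEq V] (not_ : V → V) (xs : List V) (D : Doc V (Simple V)) :
    Doc V (Simple V) :=
  D.mapBodies (Simple.push (Doc.complement not_ xs))

/-- A simplified document as a document of the closed algebra. -/
def Doc.toDocument {V : Type*} (D : Doc V (Simple V)) : Document V := D.mapBodies Simple.toSchema

/-- The not-elimination procedure: simplification, then not-completion, then not-pushing. -/
noncomputable def Document.notElimination {V : Type*} [DecidableEq V] (not_ : V → V)
    (D : Document V) : Document V :=
  ((D.simplify.notCompletion .neg not_).push not_ D.names).toDocument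

-- Guarded recursion makes the equations of an environment well founded. Whether `J` satisfies a
-- schema depends on the unguarded variables at `J` itself and on all other variables only at
-- instances of smaller depth (`Schema.mem_eval_congr`). Let `rank x` count the defined variables
-- reachable from `x` by unguarded dependency. Acyclicity makes it drop along every dependency and
-- stay below the number `n` of definitions, so that `J.depth * n + rank x` decreases at each
-- unfolding of a definition. Hence any two sequences obeying the recurrence of the semantics agree
-- on `J` and `x` once their indices exceed this measure (`Document.mem_congr_of_recurrence`). It
-- follows that the stages stabilise, that their limit solves the equations, and that the semantics
-- of a document is the meaning of its root under any solution (`Document.sem_eq_eval`).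
--
-- Two documents therefore have the same semantics as soon as one interpretation `ρ` solves both
-- environments and gives both roots the same meaning. For simplification, each body keeps its
-- meaning under `ρ`; only `pNames` uses the equations, since its pattern comes from expanding
-- definitions, and the rank bounds the depth of expansion. For not-completion, a solution of the
-- larger environment solves the smaller one and interprets `not_ x` as the complement of `ρ x`. For
-- not-pushing, under such a `ρ` each rule computes the exact complement (`Simple.eval_push`).
--
-- Guardedness survives because simplification creates no unguarded occurrence, and because
-- `Doc.base`, which identifies `x` with `not_ x`, sends each dependency after not-pushing to a
-- dependency before it. Absence of negation is an induction on the simplified schema.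

/-- The nesting depth of a JSON value. -/
def JSON.depth : JSON → ℕ
  | .arr _ f => (Finset.univ.sup fun i => (f i).depth) + 1
  | .obj _ f => (Finset.univ.sup fun k => (f k).depth) + 1
  | _ => 0

theorem JSON.depth_lt_arr {n : ℕ} (f : Fin n → JSON) (i : Fin n) :
    (f i).depth < (JSON.arr n f).depth :=
  Nat.lt_succ_of_le (Finset.le_sup (f := fun i => (f i).depth) (Finset.mem_univ i))

theorem JSON.depth_lt_obj {ks : Finset String} (f : {k // k ∈ ks} → JSON) (k : {k // k ∈ ks}) :
    (f k).depth < (JSON.obj ks f).depth :=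
  Nat.lt_succ_of_le (Finset.le_sup (f := fun i => (f i).depth) (Finset.mem_univ k))

/-- `pNames` evaluates its argument at the names, which are strings of depth `0`. The `+ 1` in the
depth makes this a strict descent whatever the member values are. -/
theorem JSON.depth_str_lt_obj {ks : Finset String} (f : {k // k ∈ ks} → JSON) (s : String) :
    (JSON.str s).depth < (JSON.obj ks f).depth :=
  Nat.succ_pos _

-- Locality of one layer of the semantics.

namespace Schema

variable {V : Type*}

theorem unguarded_subset_vars (S : Schema V) : S.unguarded ⊆ S.vars := by
  induction S <;> simp only [unguarded, vars, Set.empty_subset, Set.Subset.refl] <;>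
    first
    | assumption
    | exact Set.iUnion_mono ‹_›
    | (repeat' apply Set.union_subset_union) <;> assumption

/-- Membership in the meaning of a schema depends on the interpretation of the unguarded variables
at the instance itself, and on that of the other variables at smaller instances only. -/
theorem mem_eval_congr {ρ ρ' : V → Set JSON} (S : Schema V) : ∀ J : JSON,
    (∀ x ∈ S.unguarded, J ∈ ρ x ↔ J ∈ ρ' x) →
    (∀ J' : JSON, J'.depth < J.depth → ∀ x ∈ S.vars, J' ∈ ρ x ↔ J' ∈ ρ' x) →
    (J ∈ S.eval ρ ↔ J ∈ S.eval ρ') := by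
  -- For arguments of typed operators: these are evaluated at smaller instances only, where the
  -- second hypothesis covers guarded and unguarded occurrences alike. `X` stands for the variables
  -- of the enclosing schema.
  have deep : ∀ {S : Schema V} {J J' : JSON} {X : Set V},
      (∀ J : JSON, (∀ x ∈ S.unguarded, J ∈ ρ x ↔ J ∈ ρ' x) →
        (∀ J' : JSON, J'.depth < J.depth → ∀ x ∈ S.vars, J' ∈ ρ x ↔ J' ∈ ρ' x) →
        (J ∈ S.eval ρ ↔ J ∈ S.eval ρ')) →
      S.vars ⊆ X → (∀ J' : JSON, J'.depth < J.depth → ∀ x ∈ X, J' ∈ ρ x ↔ J' ∈ ρ' x) →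
      J'.depth < J.depth → (J' ∈ S.eval ρ ↔ J' ∈ S.eval ρ') := fun ih hX h hJ =>
    ih _ (fun x hx => h _ hJ x (hX (unguarded_subset_vars _ hx)))
      fun J'' hJ'' x hx => h J'' (hJ''.trans hJ) x (hX hx)
  induction S with
  | props n r S A ihS ihA =>
    intro J _ h
    cases J with
    | obj ks f =>
      simp only [eval, Set.mem_ofPred_eq]
      have hS := fun i k => deep (ihS i) ((Set.subset_iUnion (fun i => (S i).vars) i).trans
        Set.subset_union_left) h (JSON.depth_lt_obj f k)
      have hA := fun k => deep ihA Set.subset_union_right h (JSON.depth_lt_obj f k)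
      simp only [hS, hA]
    | _ => simp only [eval, Set.mem_ofPred_eq]
  | pNames S ih =>
    intro J _ h
    cases J with
    | obj ks f =>
      simp only [eval, Set.mem_ofPred_eq]
      have hS := fun k => deep ih subset_rfl h (JSON.depth_str_lt_obj f k)
      simp only [hS]
    | _ => simp only [eval, Set.mem_ofPred_eq]
  | items n S A ihS ihA =>
    intro J _ h
    cases J with
    | arr m f =>
      simp only [eval, Set.mem_ofPred_eq]
      have hS := fun i k => deep (ihS i) ((Set.subset_iUnion (fun i => (S i).vars) i).trans
        Set.subset_union_left) h (JSON.depth_lt_arr f k)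
      have hA := fun k => deep ihA Set.subset_union_right h (JSON.depth_lt_arr f k)
      simp only [hS, hA]
    | _ => simp only [eval, Set.mem_ofPred_eq]
  | contains S ih =>
    intro J _ h
    cases J with
    | arr m f =>
      simp only [eval, Set.mem_ofPred_eq]
      have hS := fun k => deep ih subset_rfl h (JSON.depth_lt_arr f k)
      simp only [hS]
    | _ => simp only [eval, Set.mem_ofPred_eq]
  | contAfter n S ih =>
    intro J _ h
    cases J with
    | arr m f =>
      simp only [eval, Set.mem_ofPred_eq]
      have hS := fun k => deep ih subset_rfl h (JSON.depth_lt_arr f k)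
      simp only [hS]
    | _ => simp only [eval, Set.mem_ofPred_eq]
  | pattReq n r S ih =>
    intro J _ h
    cases J with
    | obj ks f =>
      simp only [eval, Set.mem_ofPred_eq]
      have hS := fun i k => deep (ih i) (Set.subset_iUnion (fun i => (S i).vars) i) h
        (JSON.depth_lt_obj f k)
      simp only [hS]
    | _ => simp only [eval, Set.mem_ofPred_eq]
  | var x =>
    intro J h _
    exact h x rfl
  | neg S ih =>
    intro J h h'
    exact not_congr (ih J h h')
  | or S T ihS ihT =>
    intro J h h'
    exact or_congr (ihS J (fun x hx => h x (.inl hx)) fun J' hJ x hx => h' J' hJ x (.inl hx))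
      (ihT J (fun x hx => h x (.inr hx)) fun J' hJ x hx => h' J' hJ x (.inr hx))
  | and S T ihS ihT =>
    intro J h h'
    exact and_congr (ihS J (fun x hx => h x (.inl hx)) fun J' hJ x hx => h' J' hJ x (.inl hx))
      (ihT J (fun x hx => h x (.inr hx)) fun J' hJ x hx => h' J' hJ x (.inr hx))
  | imp S T ihS ihT =>
    intro J h h'
    exact or_congr (not_congr
      (ihS J (fun x hx => h x (.inl hx)) fun J' hJ x hx => h' J' hJ x (.inl hx)))
      (ihT J (fun x hx => h x (.inr hx)) fun J' hJ x hx => h' J' hJ x (.inr hx))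
  | cond S T U ihS ihT ihU =>
    intro J h h'
    have hS := ihS J (fun x hx => h x (.inl (.inl hx)))
      fun J' hJ x hx => h' J' hJ x (.inl (.inl hx))
    have hT := ihT J (fun x hx => h x (.inl (.inr hx)))
      fun J' hJ x hx => h' J' hJ x (.inl (.inr hx))
    have hU := ihU J (fun x hx => h x (.inr hx)) fun J' hJ x hx => h' J' hJ x (.inr hx)
    exact or_congr (and_congr hS hT) (and_congr (not_congr hS) hU)
  | oneOf n S ih =>
    intro J h h'
    have hS := fun i => ih i J (fun x hx => h x (Set.mem_iUnion_of_mem i hx))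
      fun J' hJ x hx => h' J' hJ x (Set.mem_iUnion_of_mem i hx)
    simp only [eval, Set.mem_ofPred_eq, hS]
  | all n S ih =>
    intro J h h'
    have hS := fun i => ih i J (fun x hx => h x (Set.mem_iUnion_of_mem i hx))
      fun J' hJ x hx => h' J' hJ x (Set.mem_iUnion_of_mem i hx)
    simp only [eval, Set.mem_iInter, hS]
  | _ => exact fun _ _ _ => Iff.rfl

/-- The interpretation of the variables at index `i`. -/
def stage [DecidableEq V] (E : List (V × Schema V)) : ℕ → V → Set JSON
  | 0, _ => ∅
  | i + 1, x =>
      match E.lookup x with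
      | some T => T.eval (stage E i)
      | none => ∅

/-- Separates the two recursions of the semantics: the index is confined to the interpretation of
the variables, and the schema contributes a single layer `eval`. -/
theorem semAt_eq_eval_stage [DecidableEq V] (E : List (V × Schema V)) (i : ℕ) (S : Schema V) :
    semAt E i S = S.eval (stage E i) := by
  induction i generalizing S with
  | zero => rw [semAt]; rfl
  | succ i ih =>
    rw [semAt]
    congr 1
    funext x
    rw [stage]
    cases E.lookup x with
    | none => rfl
    | some T => exact ih T

/-- `ρ` satisfies the equations of the environment `E`. -/
def Solves [DecidableEq V] (ρ : V → Set JSON) (E : List (V × Schema V)) : Prop :=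
  ∀ x S, E.lookup x = some S → ρ x = S.eval ρ

end Schema

-- Lookup in association lists.

theorem List.exists_lookup_of_mem_map_fst {α β : Type*} [DecidableEq α] {l : List (α × β)} {a : α}
    (h : a ∈ l.map Prod.fst) : ∃ b, l.lookup a = some b := by
  induction l with
  | nil => simp at h
  | cons p l ih =>
    obtain ⟨c, b⟩ := p
    by_cases hc : a = c
    · exact ⟨b, by simp [List.lookup, hc]⟩
    · have hb : (a == c) = false := by simpa using hc
      simp only [List.lookup, hb]
      exact ih (by simpa [hc] using h)

theorem List.mem_of_lookup_eq_some {α β : Type*} [DecidableEq α] {l : List (α × β)} {a : α} {b : β}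
    (h : l.lookup a = some b) : (a, b) ∈ l := by
  induction l with
  | nil => simp at h
  | cons p l ih =>
    obtain ⟨c, b'⟩ := p
    by_cases hc : a = c
    · subst hc
      simp only [List.lookup, beq_self_eq_true, Option.some.injEq] at h
      simp [h]
    · have hb : (a == c) = false := by simpa using hc
      simp only [List.lookup, hb] at h
      exact List.mem_cons_of_mem _ (ih h)

theorem List.lookup_eq_some_of_mem {α β : Type*} [DecidableEq α] {l : List (α × β)}
    (hl : (l.map Prod.fst).Nodup) {a : α} {b : β} (h : (a, b) ∈ l) : l.lookup a = some b := by
  obtain ⟨b', hb'⟩ := List.exists_lookup_of_mem_map_fst (List.mem_map_of_mem (f := Prod.fst) h)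
  have := List.inj_on_of_nodup_map hl (List.mem_of_lookup_eq_some hb') h rfl
  rw [hb', (Prod.mk.inj this).2]

-- Guarded recursion: stabilisation and solutions of the equations.

namespace Document

variable {V : Type*} [DecidableEq V] {D : Document V}

open Classical in
/-- The number of defined variables on which `x` depends unguardedly. -/
noncomputable def rank (D : Document V) (x : V) : ℕ :=
  (D.names.toFinset.filter (Relation.TransGen D.Depends x)).card

/-- Whatever `y` reaches, `x` reaches; and `x` reaches `y`, while by acyclicity `y` does not reach
itself. -/
theorem Guarded.rank_lt (h : D.Guarded) {x y : V} (hxy : D.Depends x y) (hy : y ∈ D.names) :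
    D.rank y < D.rank x := by
  classical
  refine Finset.card_lt_card (Finset.ssubset_iff_of_subset ?_ |>.2 ⟨y, ?_, ?_⟩)
  · exact Finset.monotone_filter_right _ fun z _ hz => .head hxy hz
  · simpa [hy] using Relation.TransGen.single hxy
  · simp [h y]

/-- Strict because `x` is defined but does not reach itself. This turns `depth * length + rank` into
a lexicographic measure. -/
theorem Guarded.rank_lt_length (h : D.Guarded) {x : V} (hx : x ∈ D.names) :
    D.rank x < D.env.length := by
  classical
  calc D.rank x < D.names.toFinset.card := Finset.card_lt_card
        (Finset.ssubset_iff_of_subset (Finset.filter_subset _ _) |>.2 ⟨x, by simpa, by simp [h x]⟩)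
    _ ≤ D.names.length := List.toFinset_card_le _
    _ = D.env.length := List.length_map _

theorem Closing.vars_subset (h : D.Closing) {x : V} {S : Schema V}
    (hS : D.env.lookup x = some S) : ∀ y ∈ S.vars, y ∈ D.names :=
  h.2 _ (List.mem_of_lookup_eq_some hS)

/-- Two sequences of interpretations that satisfy the recurrence of the semantics agree on every
instance from an index on. -/
theorem mem_congr_of_recurrence (hc : D.Closing) (hg : D.Guarded) {a b : ℕ → V → Set JSON}
    (ha : ∀ i x S, D.env.lookup x = some S → a (i + 1) x = S.eval (a i))
    (hb : ∀ i x S, D.env.lookup x = some S → b (i + 1) x = S.eval (b i))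
    (J : JSON) (x : V) (hx : x ∈ D.names) (i j : ℕ)
    (hi : J.depth * D.env.length + D.rank x < i) (hj : J.depth * D.env.length + D.rank x < j) :
    J ∈ a i x ↔ J ∈ b j x := by
  obtain ⟨d, hd⟩ : ∃ d, d = J.depth * D.env.length + D.rank x := ⟨_, rfl⟩
  induction d using Nat.strong_induction_on generalizing J x i j with
  | _ d ih =>
    obtain ⟨S, hS⟩ := List.exists_lookup_of_mem_map_fst hx
    obtain ⟨i, rfl⟩ := Nat.exists_eq_succ_of_ne_zero (Nat.ne_zero_of_lt hi)
    obtain ⟨j, rfl⟩ := Nat.exists_eq_succ_of_ne_zero (Nat.ne_zero_of_lt hj)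
    rw [Nat.succ_eq_add_one, Nat.succ_eq_add_one, ha i x S hS, hb j x S hS]
    refine S.mem_eval_congr J (fun y hy => ?_) fun J' hJ' y hy => ?_
    · have hyn := hc.vars_subset hS y (S.unguarded_subset_vars hy)
      have := hg.rank_lt ⟨S, hS, hy⟩ hyn
      exact ih _ (by omega) J y hyn i j (by omega) (by omega) rfl
    · have hyn := hc.vars_subset hS y hy
      have := hg.rank_lt_length hyn
      -- One level of depth is worth `D.env.length`, which outweighs any increase of the rank.
      have := Nat.mul_le_mul_right D.env.length (Nat.succ_le_of_lt hJ')
      rw [Nat.succ_mul] at this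
      exact ih _ (by omega) J' y hyn i j (by omega) (by omega) rfl

theorem stage_succ (D : Document V) (i : ℕ) (x : V) (S : Schema V)
    (hS : D.env.lookup x = some S) :
    Schema.stage D.env (i + 1) x = S.eval (Schema.stage D.env i) := by
  rw [Schema.stage, hS]

/-- The equations of a guarded environment have a solution. -/
theorem exists_solves (hc : D.Closing) (hg : D.Guarded) : ∃ ρ, Schema.Solves ρ D.env := by
  -- From index `N J x` on, membership of `J` in the stages of `x` no longer changes; the solution
  -- takes this final value.
  let N : JSON → V → ℕ := fun J x => J.depth * D.env.length + D.rank x + 1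
  have key : ∀ J, ∀ x ∈ D.names, ∀ i, N J x ≤ i →
      (J ∈ Schema.stage D.env i x ↔ J ∈ Schema.stage D.env (N J x) x) := fun J x hx i hi =>
    mem_congr_of_recurrence hc hg D.stage_succ D.stage_succ J x hx _ _ hi (Nat.lt_succ_self _)
  refine ⟨fun x => {J | J ∈ Schema.stage D.env (N J x) x}, fun x S hS => Set.ext fun J => ?_⟩
  have hx : x ∈ D.names := List.mem_map_of_mem (f := Prod.fst) (List.mem_of_lookup_eq_some hS)
  have hr := hg.rank_lt_length hx
  -- This index is past stabilisation for all defined variables at all instances no deeper than `J`,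
  -- and remains so after the one step spent on unfolding `x`.
  rw [Set.mem_ofPred_eq, ← key J x hx (J.depth * D.env.length + D.env.length + 1)
    (by simp only [N]; omega), D.stage_succ _ x S hS]
  refine S.mem_eval_congr J (fun y hy => ?_) fun J' hJ' y hy => ?_
  · have hyn := hc.vars_subset hS y (S.unguarded_subset_vars hy)
    have := hg.rank_lt_length hyn
    exact key J y hyn _ (by simp only [N]; omega)
  · have hyn := hc.vars_subset hS y hy
    have := hg.rank_lt_length hyn
    have := Nat.mul_le_mul_right D.env.length hJ'.le
    exact key J' y hyn _ (by simp only [N]; omega)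

/-- The semantics of a schema in a guarded environment is its meaning under any solution of the
equations of the environment. -/
theorem sem_eq_eval (hc : D.Closing) (hg : D.Guarded) {ρ : V → Set JSON}
    (hρ : Schema.Solves ρ D.env) {S : Schema V} (hS : ∀ x ∈ S.vars, x ∈ D.names) :
    S.sem D.env = S.eval ρ := by
  have key : ∀ J i, J.depth * D.env.length + D.env.length ≤ i →
      (J ∈ Schema.semAt D.env i S ↔ J ∈ S.eval ρ) := by
    intro J i hi
    have stage_iff : ∀ J' : JSON, J'.depth ≤ J.depth → ∀ x ∈ S.vars,
        (J' ∈ Schema.stage D.env i x ↔ J' ∈ ρ x) := fun J' hJ' x hx => by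
      have hr := hg.rank_lt_length (hS x hx)
      have := Nat.mul_le_mul_right D.env.length hJ'
      -- A solution is a constant sequence obeying the recurrence; its index `i + 1` matters only
      -- for the strict bound.
      exact mem_congr_of_recurrence hc hg (b := fun _ => ρ) D.stage_succ (fun _ => hρ)
        J' x (hS x hx) _ (i + 1) (by omega) (by omega)
    rw [Schema.semAt_eq_eval_stage]
    exact S.mem_eval_congr J (fun x hx => stage_iff J le_rfl x (S.unguarded_subset_vars hx))
      fun J' hJ' => stage_iff J' hJ'.le
  ext J
  simp only [Schema.sem, Set.mem_iUnion, Set.mem_iInter]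
  constructor
  · rintro ⟨i, hi⟩
    exact (key J _ (le_max_right i _)).1 (hi _ (le_max_left i _))
  · exact fun h => ⟨_, fun j hj => (key J j hj).2 h⟩

end Document

-- Languages of the derived patterns.

namespace Pattern

variable {s : String} {r r' : Pattern} {l : List Pattern}

theorem matches_alt : (alt r r').Matches s ↔ r.Matches s ∨ r'.Matches s := Iff.rfl

theorem matches_compl : (compl r).Matches s ↔ ¬ r.Matches s := Iff.rfl

theorem mem_lang_univ (w : List Char) : w ∈ univ.lang :=
  Language.mem_kstar.2 ⟨w.map fun c => [c], by simp [← List.flatMap_def], fun y hy => by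
    obtain ⟨c, -, rfl⟩ := List.mem_map.1 hy
    exact List.length_singleton⟩

theorem matches_univ : univ.Matches s := mem_lang_univ _

theorem not_matches_none : ¬ none.Matches s := fun h => h matches_univ

theorem matches_inter : (inter r r').Matches s ↔ r.Matches s ∧ r'.Matches s := by
  simp only [inter, matches_compl, matches_alt, not_or, not_not]

theorem matches_altList : (altList l).Matches s ↔ ∃ r ∈ l, r.Matches s := by
  induction l with
  | nil => simp only [List.not_mem_nil, false_and, exists_false, iff_false]; exact id
  | cons r l ih =>
    simp only [List.mem_cons, exists_eq_or_imp]
    exact or_congr Iff.rfl ih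

theorem matches_interList : (interList l).Matches s ↔ ∀ r ∈ l, r.Matches s := by
  induction l with
  | nil => exact iff_of_true matches_univ (by simp)
  | cons r l ih =>
    rw [List.forall_mem_cons]
    exact matches_inter.trans (and_congr Iff.rfl ih)

theorem matches_exact {t : String} : (exact t).Matches s ↔ s = t := by
  have key : ∀ u w : List Char, w ∈ (u.foldr (fun c r => seq (char c) r) eps).lang ↔ w = u := by
    intro u
    induction u with
    | nil => exact fun w => Language.mem_one w
    | cons c u ih =>
      intro w
      refine Language.mem_mul.trans ⟨?_, ?_⟩
      · rintro ⟨a, ha, b, hb, rfl⟩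
        rw [(ih b).1 hb, show a = [c] from ha]
        rfl
      · rintro rfl
        exact ⟨[c], rfl, u, (ih u).2 rfl, rfl⟩
  exact (key _ _).trans String.toList_inj

theorem mem_lang_anyPow {n : ℕ} {w : List Char} : w ∈ (anyPow n).lang ↔ w.length = n := by
  induction n generalizing w with
  | zero => exact (Language.mem_one w).trans List.length_eq_zero_iff.symm
  | succ n ih =>
    refine Language.mem_mul.trans ⟨?_, ?_⟩
    · rintro ⟨a, ha, b, hb, rfl⟩
      rw [List.length_append, ih.1 hb, show a.length = 1 from ha, add_comm]
    · intro h
      cases w with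
      | nil => simp at h
      | cons c w => exact ⟨[c], List.length_singleton, w, ih.2 (by simpa using h), rfl⟩

theorem matches_lenBetween {a : ℕ} {j : ℕ∞} :
    (lenBetween a j).Matches s ↔ a ≤ s.length ∧ (s.length : ℕ∞) ≤ j := by
  rw [← String.length_toList]
  induction j with
  | top =>
    rw [lenBetween, if_pos rfl, and_iff_left le_top]
    refine Language.mem_mul.trans ⟨?_, fun h => ?_⟩
    · rintro ⟨u, hu, v, -, huv⟩
      rw [← huv, List.length_append, mem_lang_anyPow.1 hu]
      exact Nat.le_add_right _ _
    · exact ⟨s.toList.take a, mem_lang_anyPow.2 (List.length_take_of_le h), _, mem_lang_univ _,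
        List.take_append_drop _ _⟩
  | coe j =>
    rw [lenBetween, if_neg (ENat.natCast_ne_top j), matches_altList]
    simp only [List.mem_map, List.mem_filter, List.mem_range, ENat.toNat_natCast, decide_eq_true_eq,
      Nat.cast_le, Nat.lt_succ_iff]
    constructor
    · rintro ⟨r, ⟨n, hn, rfl⟩, hr⟩
      rw [mem_lang_anyPow.1 hr]
      exact hn.symm
    · exact fun h => ⟨_, ⟨_, h.symm, rfl⟩, mem_lang_anyPow.2 rfl⟩

end Pattern

-- The strings that satisfy a schema, as a pattern.

namespace Schema

variable {V : Type*}

/-- At a string a schema is a boolean combination of string conditions and variables, and patterns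
are closed under boolean operations. Nothing below a typed operator is inspected, so agreement on
the unguarded variables is enough. -/
theorem matches_pattOf {ρ : V → Set JSON} {p : V → Pattern} {s : String} (S : Schema V)
    (h : ∀ x ∈ S.unguarded, (p x).Matches s ↔ JSON.str s ∈ ρ x) :
    (S.pattOf p).Matches s ↔ JSON.str s ∈ S.eval ρ := by
  induction S with
  | type n T =>
    simp only [pattOf, Pattern.matches_altList, List.mem_ofFn, exists_exists_eq_and, eval,
      Set.mem_ofPred_eq, JSON.typeOf]
    refine exists_congr fun i => ?_
    cases T i <;> simp [Pattern.matches_univ, Pattern.not_matches_none]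
  | const J => cases J <;> simp [pattOf, eval, Pattern.not_matches_none, Pattern.matches_exact]
  | enum n J =>
    simp only [pattOf, Pattern.matches_altList, List.mem_ofFn, exists_exists_eq_and, eval,
      Set.mem_ofPred_eq]
    refine exists_congr fun i => ?_
    cases J i <;> simp [Pattern.not_matches_none, Pattern.matches_exact]
  | len l j => exact Pattern.matches_lenBetween
  | pattern r => exact Iff.rfl
  | var x => exact h x rfl
  | tt => exact iff_of_true Pattern.matches_univ trivial
  | ff => exact iff_of_false Pattern.not_matches_none id
  | neg S ih => exact not_congr (ih h)
  | or S T ihS ihT =>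
    exact or_congr (ihS fun x hx => h x (.inl hx)) (ihT fun x hx => h x (.inr hx))
  | imp S T ihS ihT =>
    exact or_congr (not_congr (ihS fun x hx => h x (.inl hx))) (ihT fun x hx => h x (.inr hx))
  | and S T ihS ihT =>
    exact Pattern.matches_inter.trans
      (and_congr (ihS fun x hx => h x (.inl hx)) (ihT fun x hx => h x (.inr hx)))
  | cond S T U ihS ihT ihU =>
    have hS := ihS fun x hx => h x (.inl (.inl hx))
    exact or_congr
      (Pattern.matches_inter.trans (and_congr hS (ihT fun x hx => h x (.inl (.inr hx)))))
      (Pattern.matches_inter.trans (and_congr (not_congr hS) (ihU fun x hx => h x (.inr hx))))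
  | oneOf n S ih =>
    have hS := fun i => ih i fun x hx => h x (Set.mem_iUnion_of_mem i hx)
    simp only [pattOf, Pattern.matches_altList, List.mem_ofFn, exists_exists_eq_and, eval,
      Set.mem_ofPred_eq]
    simp only [Pattern.matches_interList, List.forall_mem_ofFn_iff]
    refine exists_congr fun l => ⟨fun H => ⟨?_, fun k hk => ?_⟩, fun H k => ?_⟩
    · simpa only [if_true, hS] using H l
    · simpa only [if_neg hk, Pattern.matches_compl, hS] using H k
    · split_ifs with hk
      · exact hk ▸ (hS l).2 H.1
      · exact Pattern.matches_compl.2 fun hm => H.2 k hk ((hS k).1 hm)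
  | all n S ih =>
    have hS := fun i => ih i fun x hx => h x (Set.mem_iUnion_of_mem i hx)
    simp only [pattOf, Pattern.matches_interList, List.forall_mem_ofFn_iff, eval, Set.mem_iInter,
      hS]
  | _ => exact iff_of_true Pattern.matches_univ (by simp only [eval, Set.mem_ofPred_eq])

end Schema

namespace Document

variable {V : Type*} [DecidableEq V] {D : Document V} {ρ : V → Set JSON}

/-- Each expansion follows an unguarded dependency and lowers the rank, so the default
`Pattern.none` at depth `0` is never met. -/
theorem matches_pattVar (hc : D.Closing) (hg : D.Guarded) (hρ : Schema.Solves ρ D.env)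
    (s : String) (d : ℕ) (x : V) (hx : x ∈ D.names) (hd : D.rank x < d) :
    (Schema.pattVar D.env d x).Matches s ↔ JSON.str s ∈ ρ x := by
  induction d generalizing x with
  | zero => exact absurd hd (Nat.not_lt_zero _)
  | succ d ih =>
    obtain ⟨S, hS⟩ := List.exists_lookup_of_mem_map_fst hx
    rw [hρ x S hS, Schema.pattVar, hS]
    refine S.matches_pattOf fun y hy => ?_
    have hyn := hc.vars_subset hS y (S.unguarded_subset_vars hy)
    exact ih y hyn ((hg.rank_lt ⟨S, hS, hy⟩ hyn).trans_le (Nat.le_of_lt_succ hd))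

theorem matches_pattIn (hc : D.Closing) (hg : D.Guarded) (hρ : Schema.Solves ρ D.env)
    (s : String) {S : Schema V} (hS : ∀ x ∈ S.vars, x ∈ D.names) :
    (Schema.pattIn D.env S).Matches s ↔ JSON.str s ∈ S.eval ρ :=
  S.matches_pattOf fun x hx =>
    have hxn := hS x (S.unguarded_subset_vars hx)
    matches_pattVar hc hg hρ s _ x hxn (hg.rank_lt_length hxn)

end Document

-- Simplification preserves the meaning of schemas.

namespace Simple

variable {V : Type*} {ρ : V → Set JSON} {J : JSON}

theorem mem_eval_bigAnd {l : List (Simple V)} :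
    J ∈ (bigAnd l).toSchema.eval ρ ↔ ∀ S ∈ l, J ∈ S.toSchema.eval ρ := by
  induction l with
  | nil => simp [bigAnd, toSchema, Schema.eval]
  | cons S l ih =>
    cases l with
    | nil => simp [bigAnd]
    | cons T l =>
      rw [List.forall_mem_cons, ← ih]
      exact Iff.rfl

theorem mem_eval_bigOr {l : List (Simple V)} :
    J ∈ (bigOr l).toSchema.eval ρ ↔ ∃ S ∈ l, J ∈ S.toSchema.eval ρ := by
  induction l with
  | nil => simp [bigOr, toSchema, Schema.eval]
  | cons S l ih =>
    cases l with
    | nil => simp [bigOr]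
    | cons T l =>
      have : (∃ U ∈ S :: T :: l, J ∈ U.toSchema.eval ρ) ↔
          J ∈ S.toSchema.eval ρ ∨ ∃ U ∈ T :: l, J ∈ U.toSchema.eval ρ := by
        rw [← exists_eq_or_imp (p := fun U : Simple V => J ∈ U.toSchema.eval ρ)]
        simp only [List.mem_cons]
      rw [this, ← ih]
      exact Iff.rfl

theorem eval_bound {op : ℕ → ℕ∞ → Simple V} (h : (op 0 ⊤).toSchema.eval ρ = Set.univ) (l : ℕ)
    (j : ℕ∞) : (bound op l j).toSchema.eval ρ = (op l j).toSchema.eval ρ := by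
  rw [bound]
  split_ifs with hb
  · rw [hb.1, hb.2, h]
    rfl
  · rfl

theorem eval_realBound {op : WithBot ℝ → WithTop ℝ → Simple V}
    (h : (op ⊥ ⊤).toSchema.eval ρ = Set.univ) (m : WithBot ℝ) (M : WithTop ℝ) :
    (realBound op m M).toSchema.eval ρ = (op m M).toSchema.eval ρ := by
  rw [realBound]
  split_ifs with hb
  · rw [hb.1, hb.2, h]
    rfl
  · rfl

/-- Of the `i + 1` positional schemas only the last is not `tt`; an array that is too short
satisfies it vacuously. -/
theorem arr_mem_eval_itemAt {m i : ℕ} {f : Fin m → JSON} {S : Simple V} :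
    JSON.arr m f ∈ (itemAt i S).toSchema.eval ρ ↔
      ∀ l : Fin m, l.1 = i → f l ∈ S.toSchema.eval ρ := by
  simp only [toSchema, Schema.eval, Set.mem_ofPred_eq, Set.mem_univ, implies_true, and_true]
  refine forall_congr' fun l => ⟨fun H hl => ?_, fun H j hj => ?_⟩
  · simpa using H (Fin.last i) hl
  · split_ifs with h
    · exact H (by rw [hj, h]; rfl)
    · trivial

theorem mem_eval_ofConst (J J₀ : JSON) : J ∈ (ofConst J₀).toSchema.eval ρ ↔ J = J₀ := by
  induction J₀ generalizing J with
  | null => cases J <;> simp [ofConst, toSchema, Schema.eval, JSON.typeOf]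
  | bool b => rfl
  | num x =>
    cases J <;> simp [ofConst, toSchema, Schema.eval, JSON.typeOf]
    exact ⟨fun h => le_antisymm h.2 h.1, fun h => ⟨h.ge, h.le⟩⟩
  | str s =>
    cases J <;> simp [ofConst, toSchema, Schema.eval, JSON.typeOf, Pattern.matches_exact]
  | arr n f ih =>
    simp only [ofConst, mem_eval_bigAnd, List.forall_mem_append, List.forall_mem_cons,
      List.forall_mem_ofFn_iff]
    cases J with
    | arr m g =>
      simp only [arr_mem_eval_itemAt, ih]
      simp only [toSchema, Schema.eval, JSON.typeOf, Set.mem_ofPred_eq, Nat.cast_le]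
      constructor
      · rintro ⟨⟨-, ⟨h₁, h₂⟩, -⟩, h⟩
        obtain rfl := le_antisymm h₁ h₂
        rw [show g = f from funext fun i => h i i rfl]
      · intro h
        cases h
        exact ⟨⟨⟨0, trivial⟩, ⟨le_rfl, le_rfl⟩, by simp⟩, fun i l hl => by rw [Fin.ext hl]⟩
    | _ => exact iff_of_false (fun h => by simpa [toSchema, Schema.eval, JSON.typeOf] using h.1.1) nofun
  | obj ks f ih =>
    simp only [ofConst, mem_eval_bigAnd, List.forall_mem_append, List.forall_mem_cons,
      List.forall_mem_map, Finset.mem_toList]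
    cases J with
    | obj ks' g =>
      simp only [toSchema, Schema.eval, JSON.typeOf, Set.mem_ofPred_eq, Nat.cast_le,
        Pattern.matches_exact, Set.mem_univ, implies_true, and_true, ih, Finset.mem_attach,
        forall_const, zero_le, true_and]
      constructor
      · rintro ⟨⟨⟨-, h₁⟩, h₂, -⟩, h₃⟩
        -- The required names give one inclusion, and the cap `pro 0 ks.card` on the number of
        -- members forces equality.
        have hsub : ks ⊆ ks' := fun k hk => by
          obtain ⟨⟨k', hk'⟩, rfl⟩ := h₁ k hk
          exact hk'
        obtain rfl := Finset.eq_of_subset_of_card_le hsub h₂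
        rw [show g = f from funext fun k => h₃ k k rfl]
      · intro h
        cases h
        exact ⟨⟨⟨⟨⟨0, trivial⟩, by simp⟩, fun k hk => ⟨⟨k, hk⟩, rfl⟩⟩, le_rfl, by simp⟩,
          fun k l hl => by rw [Subtype.ext hl]⟩
    | _ => exact iff_of_false (fun h => by simpa [toSchema, Schema.eval, JSON.typeOf] using h.1.1.1.1) nofun

end Simple

namespace Schema

variable {V : Type*} [DecidableEq V] {D : Document V} {ρ : V → Set JSON}

open Simple in
-- All rewritings but that of `pNames` are equivalences under every interpretation; the pattern for
-- `pNames` expands variables, so there `ρ` has to solve the environment.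
theorem eval_toSchema_simplify (hc : D.Closing) (hg : D.Guarded) (hρ : Solves ρ D.env)
    (S : Schema V) (hS : ∀ x ∈ S.vars, x ∈ D.names) :
    (S.simplify D.env).toSchema.eval ρ = S.eval ρ := by
  induction S with
  | type n T =>
    ext J
    simp only [simplify, mem_eval_bigOr, List.mem_ofFn, exists_exists_eq_and]
    simp only [toSchema, eval, Set.mem_ofPred_eq, exists_const]
  | const J =>
    ext J'
    exact mem_eval_ofConst J' J
  | enum n J =>
    ext J'
    simp only [simplify, mem_eval_bigOr, List.mem_ofFn, exists_exists_eq_and, mem_eval_ofConst,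
      eval, Set.mem_ofPred_eq]
  | len l j =>
    refine eval_bound (Set.eq_univ_of_forall fun J => ?_) l j
    cases J <;> simp only [toSchema, eval, Set.mem_ofPred_eq, zero_le, le_top, and_self]
  | pro l j =>
    refine eval_bound (Set.eq_univ_of_forall fun J => ?_) l j
    cases J <;> simp only [toSchema, eval, Set.mem_ofPred_eq, zero_le, le_top, and_self]
  | ite l j =>
    refine eval_bound (Set.eq_univ_of_forall fun J => ?_) l j
    cases J <;> simp only [toSchema, eval, Set.mem_ofPred_eq, zero_le, le_top, and_self]
  | betw m M =>
    refine eval_realBound (Set.eq_univ_of_forall fun J => ?_) m M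
    cases J <;> simp only [toSchema, eval, Set.mem_ofPred_eq, bot_le, le_top, and_self]
  | xBetw m M =>
    refine eval_realBound (Set.eq_univ_of_forall fun J => ?_) m M
    cases J <;> simp only [toSchema, eval, Set.mem_ofPred_eq, WithBot.bot_lt_coe, WithTop.coe_lt_top, and_self]
  | props n r S A ihS ihA =>
    have hS' := fun i => ihS i fun x hx => hS x (.inl (Set.mem_iUnion_of_mem i hx))
    have hA' := ihA fun x hx => hS x (.inr hx)
    ext J
    simp only [simplify, mem_eval_bigAnd, List.forall_mem_append, List.forall_mem_ofFn_iff,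
      List.forall_mem_singleton]
    cases J with
    | obj ks f =>
      simp only [toSchema, eval, Set.mem_ofPred_eq, Set.mem_univ, implies_true, and_true, hS',
        hA', Pattern.matches_compl, Pattern.matches_altList, List.mem_ofFn, exists_exists_eq_and,
        not_exists, forall_const]
      exact ⟨fun H k => ⟨fun j => H.1 j k, H.2 k⟩, fun H => ⟨fun j k => (H k).1 j, fun k => (H k).2⟩⟩
    | _ => simp only [toSchema, eval, Set.mem_ofPred_eq, implies_true, and_self]
  | req n k =>
    ext J
    simp only [simplify, mem_eval_bigAnd, List.forall_mem_ofFn_iff]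
    cases J with
    | obj ks f =>
      simp only [toSchema, eval, Set.mem_ofPred_eq, Pattern.matches_exact, Set.mem_univ, and_true,
        forall_const, Subtype.exists, exists_prop, exists_eq_right]
    | _ => simp only [toSchema, eval, Set.mem_ofPred_eq, implies_true]
  | pNames S ih =>
    ext J
    cases J with
    | obj ks f =>
      -- `props r ff` forbids the names matching `r`, here those that violate `S`, so the two
      -- negations cancel.
      simp only [simplify, toSchema, eval, Set.mem_ofPred_eq, Set.mem_univ, implies_true, and_true,
        Document.matches_pattIn hc hg hρ _ (S := .neg S) hS, Set.mem_compl_iff, Set.mem_empty_iff_false,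
        imp_false, not_not, forall_const, Subtype.forall]
    | _ => simp only [simplify, toSchema, eval, Set.mem_ofPred_eq]
  | items n S A ihS ihA =>
    have hS' := fun i => ihS i fun x hx => hS x (.inl (Set.mem_iUnion_of_mem i hx))
    have hA' := ihA fun x hx => hS x (.inr hx)
    ext J
    simp only [simplify, mem_eval_bigAnd, List.forall_mem_append, List.forall_mem_ofFn_iff,
      List.forall_mem_singleton]
    cases J with
    | arr m f =>
      simp only [arr_mem_eval_itemAt, hS']
      simp only [toSchema, eval, Set.mem_ofPred_eq, Set.mem_univ, implies_true, true_and, hA']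
      exact ⟨fun H k => ⟨fun j => H.1 j k, H.2 k⟩, fun H => ⟨fun j k => (H k).1 j, fun k => (H k).2⟩⟩
    | _ => simp only [toSchema, eval, Set.mem_ofPred_eq, implies_true, and_self]
  | contains S ih =>
    ext J
    cases J <;> simp only [simplify, toSchema, eval, Set.mem_ofPred_eq, ih hS, zero_le, true_and]
  | contAfter n S ih =>
    ext J
    cases J <;> simp only [simplify, toSchema, eval, Set.mem_ofPred_eq, ih hS]
  | pattReq n r S ih =>
    have hS' := fun i => ih i fun x hx => hS x (Set.mem_iUnion_of_mem i hx)
    ext J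
    simp only [simplify, mem_eval_bigAnd, List.forall_mem_ofFn_iff]
    cases J <;> simp only [toSchema, eval, Set.mem_ofPred_eq, implies_true, forall_const, hS']
  | neg S ih => exact congrArg (·ᶜ) (ih hS)
  | or S T ihS ihT =>
    exact congrArg₂ (· ∪ ·) (ihS fun x hx => hS x (.inl hx)) (ihT fun x hx => hS x (.inr hx))
  | and S T ihS ihT =>
    exact congrArg₂ (· ∩ ·) (ihS fun x hx => hS x (.inl hx)) (ihT fun x hx => hS x (.inr hx))
  | imp S T ihS ihT =>
    exact congrArg₂ (fun X Y => Xᶜ ∪ Y) (ihS fun x hx => hS x (.inl hx))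
      (ihT fun x hx => hS x (.inr hx))
  | cond S T U ihS ihT ihU =>
    simp only [simplify, toSchema, eval, ihS fun x hx => hS x (.inl (.inl hx)),
      ihT fun x hx => hS x (.inl (.inr hx)), ihU fun x hx => hS x (.inr hx)]
  | oneOf n S ih =>
    have hS' := fun i => ih i fun x hx => hS x (Set.mem_iUnion_of_mem i hx)
    ext J
    simp only [simplify, mem_eval_bigOr, List.mem_ofFn, exists_exists_eq_and, eval,
      Set.mem_ofPred_eq]
    simp only [mem_eval_bigAnd, List.forall_mem_ofFn_iff]
    refine exists_congr fun l => ⟨fun H => ⟨?_, fun k hk => ?_⟩, fun H k => ?_⟩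
    · simpa only [if_true, hS'] using H l
    · simpa only [if_neg hk, toSchema, eval, hS', Set.mem_compl_iff] using H k
    · split_ifs with hk
      · rw [hk, hS']
        exact H.1
      · simp only [toSchema, eval, hS']
        exact H.2 k hk
  | all n S ih =>
    have hS' := fun i => ih i fun x hx => hS x (Set.mem_iUnion_of_mem i hx)
    ext J
    simp only [simplify, mem_eval_bigAnd, List.forall_mem_ofFn_iff, hS', eval, Set.mem_iInter]
  | _ => rfl

end Schema

-- Not-pushing preserves the meaning of schemas.

namespace Simple

variable {V : Type*} {ρ : V → Set JSON} {J : JSON}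

theorem mem_eval_type {T : JType} : J ∈ (type T : Simple V).toSchema.eval ρ ↔ J.typeOf = T := by
  simp only [toSchema, Schema.eval, Set.mem_ofPred_eq, exists_const]

theorem mem_eval_and {S T : Simple V} :
    J ∈ (and S T).toSchema.eval ρ ↔ J ∈ S.toSchema.eval ρ ∧ J ∈ T.toSchema.eval ρ := Iff.rfl

theorem mem_eval_or {S T : Simple V} :
    J ∈ (or S T).toSchema.eval ρ ↔ J ∈ S.toSchema.eval ρ ∨ J ∈ T.toSchema.eval ρ := Iff.rfl

theorem mem_eval_otherTypes {T : JType} :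
    J ∈ (otherTypes T : Simple V).toSchema.eval ρ ↔ J.typeOf ≠ T := by
  cases T <;> rw [otherTypes, mem_eval_bigOr] <;>
    simp only [List.mem_cons, List.not_mem_nil, or_false, exists_eq_or_imp, exists_eq_left,
      mem_eval_type] <;>
    cases J.typeOf <;> simp only [reduceCtorEq, or_self, or_true, true_or, ne_eq, not_true,
      not_false_eq_true]

theorem mem_eval_outside {op : ℕ → ℕ∞ → Simple V} {l : ℕ} {j : ℕ∞} :
    J ∈ (outside op l j).toSchema.eval ρ ↔
      (l ≠ 0 ∧ J ∈ (op 0 (l - 1 : ℕ)).toSchema.eval ρ) ∨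
        (j ≠ ⊤ ∧ J ∈ (op (j.toNat + 1) ⊤).toSchema.eval ρ) := by
  rw [outside, mem_eval_bigOr]
  by_cases hl : l = 0 <;> by_cases hj : j = ⊤ <;> simp [hl, hj]

theorem mem_eval_realOutside {op : WithBot ℝ → WithTop ℝ → Simple V} {m : WithBot ℝ}
    {M : WithTop ℝ} : J ∈ (realOutside op m M).toSchema.eval ρ ↔
      (∃ a : ℝ, m = a ∧ J ∈ (op ⊥ a).toSchema.eval ρ) ∨
        ∃ a : ℝ, M = a ∧ J ∈ (op a ⊤).toSchema.eval ρ := by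
  rw [realOutside, mem_eval_bigOr]
  induction m <;> induction M <;> simp

end Simple

/-- The truncated `l - 1` at `l = 0` and the value `0` of `toNat` at `⊤` do no harm, being excluded
by `l ≠ 0` and `j ≠ ⊤`. The trivial bounds match the shape of the operators in `outside`. -/
theorem not_between_iff (l n : ℕ) (j : ℕ∞) :
    ((l ≠ 0 ∧ 0 ≤ n ∧ (n : ℕ∞) ≤ (l - 1 : ℕ)) ∨ (j ≠ ⊤ ∧ j.toNat + 1 ≤ n ∧ (n : ℕ∞) ≤ ⊤)) ↔
      ¬ (l ≤ n ∧ (n : ℕ∞) ≤ j) := by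
  induction j with
  | top =>
    simp only [Nat.cast_le, le_top, ne_eq, not_true, false_and, or_false, and_true]
    omega
  | coe j =>
    simp only [Nat.cast_le, le_top, ne_eq, ENat.natCast_ne_top, ENat.toNat_natCast, not_false_eq_true,
      true_and, and_true]
    omega

namespace Simple

variable {V : Type*} {ρ : V → Set JSON} {J : JSON}

/-- Shared by `len`, `pro` and `ite`: `c` reads off the size of an instance, and its value outside
the type `T` is immaterial. -/
theorem eval_pushNeg_bound {T : JType} {op : ℕ → ℕ∞ → Simple V} (c : JSON → ℕ)
    (h : ∀ l j J, J ∈ (op l j).toSchema.eval ρ ↔ (J.typeOf = T → l ≤ c J ∧ (c J : ℕ∞) ≤ j))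
    (l : ℕ) (j : ℕ∞) :
    (and (type T) (outside op l j)).toSchema.eval ρ = ((op l j).toSchema.eval ρ)ᶜ := by
  ext J
  rw [mem_eval_and, mem_eval_type, mem_eval_outside, Set.mem_compl_iff, h, h, h]
  have := not_between_iff l (c J) j
  tauto

/-- A typed operator can fail only on instances of its type, which is why the negated forms carry a
type conjunct. `push` and `pushNeg` call each other at negations, hence the joint induction; the
hypothesis on `ρ` acts at the variables. -/
theorem eval_push (co : V → V) (S : Simple V)
    (h : ∀ x ∈ S.toSchema.vars, ρ (co x) = (ρ x)ᶜ) :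
    (push co S).toSchema.eval ρ = S.toSchema.eval ρ ∧
      (pushNeg co S).toSchema.eval ρ = (S.toSchema.eval ρ)ᶜ := by
  induction S with
  | type T =>
    refine ⟨rfl, Set.ext fun J => ?_⟩
    rw [pushNeg, mem_eval_otherTypes, Set.mem_compl_iff, mem_eval_type]
  | bool b =>
    refine ⟨rfl, Set.ext fun J => ?_⟩
    rw [pushNeg, mem_eval_or, mem_eval_otherTypes, Set.mem_compl_iff]
    simp only [toSchema, Schema.eval, Set.mem_ofPred_eq]
    cases J with
    | bool c => cases b <;> cases c <;> simp [JSON.typeOf]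
    | _ => simp [JSON.typeOf]
  | len l j =>
    refine ⟨rfl, eval_pushNeg_bound
      (fun J => match J with | .str s => s.length | _ => 0) (fun l j J => ?_) l j⟩
    cases J <;> simp only [toSchema, Schema.eval, Set.mem_ofPred_eq, JSON.typeOf, reduceCtorEq,
      false_imp_iff, forall_const]
  | pro l j =>
    refine ⟨rfl, eval_pushNeg_bound
      (fun J => match J with | .obj ks _ => ks.card | _ => 0) (fun l j J => ?_) l j⟩
    cases J <;> simp only [toSchema, Schema.eval, Set.mem_ofPred_eq, JSON.typeOf, reduceCtorEq,
      false_imp_iff, forall_const]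
  | ite l j =>
    refine ⟨rfl, eval_pushNeg_bound
      (fun J => match J with | .arr n _ => n | _ => 0) (fun l j J => ?_) l j⟩
    cases J <;> simp only [toSchema, Schema.eval, Set.mem_ofPred_eq, JSON.typeOf, reduceCtorEq,
      false_imp_iff, forall_const]
  | betw m M =>
    refine ⟨rfl, Set.ext fun J => ?_⟩
    rw [pushNeg, mem_eval_and, mem_eval_type, mem_eval_realOutside, Set.mem_compl_iff]
    cases J with
    | num x =>
      simp only [toSchema, Schema.eval, Set.mem_ofPred_eq, JSON.typeOf]
      induction m <;> induction M <;> simp [imp_iff_not_or]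
    | _ => simp [toSchema, Schema.eval, JSON.typeOf]
  | xBetw m M =>
    refine ⟨rfl, Set.ext fun J => ?_⟩
    rw [pushNeg, mem_eval_and, mem_eval_type, mem_eval_realOutside, Set.mem_compl_iff]
    cases J with
    | num x =>
      simp only [toSchema, Schema.eval, Set.mem_ofPred_eq, JSON.typeOf]
      induction m <;> induction M <;> simp [imp_iff_not_or]
    | _ => simp [toSchema, Schema.eval, JSON.typeOf]
  | mulOf q =>
    refine ⟨rfl, Set.ext fun J => ?_⟩
    rw [pushNeg, mem_eval_and, mem_eval_type, Set.mem_compl_iff]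
    cases J <;> simp only [toSchema, Schema.eval, Set.mem_ofPred_eq, JSON.typeOf, reduceCtorEq,
      true_and, false_and, not_true]
  | notMulOf q =>
    refine ⟨rfl, Set.ext fun J => ?_⟩
    rw [pushNeg, mem_eval_and, mem_eval_type, Set.mem_compl_iff]
    cases J <;> simp only [toSchema, Schema.eval, Set.mem_ofPred_eq, JSON.typeOf, reduceCtorEq,
      true_and, false_and, not_true, not_not]
  | pattern r =>
    refine ⟨rfl, Set.ext fun J => ?_⟩
    rw [pushNeg, mem_eval_and, mem_eval_type, Set.mem_compl_iff]
    cases J <;> simp only [toSchema, Schema.eval, Set.mem_ofPred_eq, JSON.typeOf, reduceCtorEq,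
      true_and, false_and, not_true, Pattern.matches_compl]
  | uniqueItems =>
    refine ⟨rfl, Set.ext fun J => ?_⟩
    rw [pushNeg, mem_eval_and, mem_eval_type, Set.mem_compl_iff]
    cases J <;> simp only [toSchema, Schema.eval, Set.mem_ofPred_eq, JSON.typeOf, reduceCtorEq,
      true_and, false_and, not_true, not_forall, not_not, exists_prop, ne_eq]
  | repeatedItems =>
    refine ⟨rfl, Set.ext fun J => ?_⟩
    rw [pushNeg, mem_eval_and, mem_eval_type, Set.mem_compl_iff]
    cases J <;> simp only [toSchema, Schema.eval, Set.mem_ofPred_eq, JSON.typeOf, reduceCtorEq,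
      true_and, false_and, not_true, not_exists, not_and, ne_eq]
  | props r S ih =>
    obtain ⟨ih₁, ih₂⟩ := ih fun x hx => h x (.inl (Set.mem_iUnion_of_mem 0 hx))
    refine ⟨by rw [push]; simp only [toSchema, Schema.eval, ih₁], Set.ext fun J => ?_⟩
    rw [pushNeg, mem_eval_and, mem_eval_type, Set.mem_compl_iff]
    cases J <;> simp only [toSchema, Schema.eval, Set.mem_ofPred_eq, JSON.typeOf, reduceCtorEq,
      true_and, not_true, ih₂, forall_const, Set.mem_univ, implies_true, and_true,
      not_forall, exists_prop, Set.mem_compl_iff]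
  | pattReq r S ih =>
    obtain ⟨ih₁, ih₂⟩ := ih fun x hx => h x (Set.mem_iUnion_of_mem 0 hx)
    refine ⟨by rw [push]; simp only [toSchema, Schema.eval, ih₁], Set.ext fun J => ?_⟩
    rw [pushNeg, mem_eval_and, mem_eval_type, Set.mem_compl_iff]
    cases J <;> simp only [toSchema, Schema.eval, Set.mem_ofPred_eq, JSON.typeOf, reduceCtorEq,
      true_and, not_true, ih₂, forall_const, Set.mem_univ, implies_true, and_true,
      not_exists, not_and, Set.mem_compl_iff]
  | itemAt i S ih =>
    obtain ⟨ih₁, ih₂⟩ := ih fun x hx =>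
      h x (.inl (Set.mem_iUnion_of_mem (Fin.last i) (by simpa using hx)))
    rw [push, pushNeg]
    refine ⟨Set.ext fun J => ?_, Set.ext fun J => ?_⟩
    · cases J with
      | arr m f => simp only [arr_mem_eval_itemAt, ih₁]
      | _ => simp only [toSchema, Schema.eval, Set.mem_ofPred_eq]
    · simp only [mem_eval_bigAnd, List.forall_mem_cons, mem_eval_type, Set.mem_compl_iff]
      cases J with
      | arr m f =>
        simp only [arr_mem_eval_itemAt, ih₂, Set.mem_compl_iff]
        simp only [toSchema, Schema.eval, Set.mem_ofPred_eq, JSON.typeOf, le_top, true_and,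
          and_true, List.not_mem_nil, false_imp_iff, implies_true, not_forall, exists_prop]
        constructor
        -- The conjunct `ite (i + 1) ⊤` provides the element at index `i`; without it a short array
        -- would satisfy the negated `itemAt` vacuously.
        · exact fun H => ⟨⟨i, H.2⟩, rfl, H.1 _ rfl⟩
        · rintro ⟨l, rfl, hl⟩
          exact ⟨fun k hk => Fin.ext hk ▸ hl, l.2⟩
      | _ => simp only [toSchema, Schema.eval, Set.mem_ofPred_eq, JSON.typeOf, reduceCtorEq,
          false_and, not_true]
  | itemsAfter n S ih =>
    obtain ⟨ih₁, ih₂⟩ := ih fun x hx => h x (.inr hx)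
    refine ⟨by rw [push]; simp only [toSchema, Schema.eval, ih₁], Set.ext fun J => ?_⟩
    rw [pushNeg, mem_eval_and, mem_eval_type, Set.mem_compl_iff]
    cases J <;> simp only [toSchema, Schema.eval, Set.mem_ofPred_eq, JSON.typeOf, reduceCtorEq,
      true_and, false_and, not_true, ih₂, Set.mem_univ, implies_true,
      not_forall, exists_prop, Set.mem_compl_iff]
  | contAfter n S ih =>
    obtain ⟨ih₁, ih₂⟩ := ih h
    refine ⟨by rw [push]; simp only [toSchema, Schema.eval, ih₁], Set.ext fun J => ?_⟩
    rw [pushNeg, mem_eval_and, mem_eval_type, Set.mem_compl_iff]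
    cases J <;> simp only [toSchema, Schema.eval, Set.mem_ofPred_eq, JSON.typeOf, reduceCtorEq,
      true_and, false_and, not_true, ih₂, Set.mem_univ, implies_true,
      not_exists, not_and, Set.mem_compl_iff]
  | var x => exact ⟨rfl, h x rfl⟩
  | tt => exact ⟨rfl, Set.compl_univ.symm⟩
  | ff => exact ⟨rfl, Set.compl_empty.symm⟩
  | neg S ih =>
    obtain ⟨ih₁, ih₂⟩ := ih h
    exact ⟨by rw [push, ih₂]; rfl, by rw [pushNeg, ih₁]; exact (compl_compl _).symm⟩
  | and S T ihS ihT =>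
    obtain ⟨ih₁, ih₂⟩ := ihS fun x hx => h x (.inl hx)
    obtain ⟨ih₃, ih₄⟩ := ihT fun x hx => h x (.inr hx)
    rw [push, pushNeg]
    simp only [toSchema, Schema.eval, ih₁, ih₂, ih₃, ih₄, Set.compl_inter, and_self]
  | or S T ihS ihT =>
    obtain ⟨ih₁, ih₂⟩ := ihS fun x hx => h x (.inl hx)
    obtain ⟨ih₃, ih₄⟩ := ihT fun x hx => h x (.inr hx)
    rw [push, pushNeg]
    simp only [toSchema, Schema.eval, ih₁, ih₂, ih₃, ih₄, Set.compl_union, and_self]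

end Simple

-- Syntactic invariants: variables, unguarded occurrences, absence of negation.

namespace Simple

variable {V : Type*}

theorem vars_toSchema_props (r : Pattern) (S : Simple V) :
    (props r S).toSchema.vars = S.toSchema.vars := by
  simp only [toSchema, Schema.vars, Set.iUnion_const, Set.union_empty]

theorem vars_toSchema_pattReq (r : Pattern) (S : Simple V) :
    (pattReq r S).toSchema.vars = S.toSchema.vars := by
  simp only [toSchema, Schema.vars, Set.iUnion_const]

theorem vars_toSchema_itemAt (i : ℕ) (S : Simple V) :
    (itemAt i S).toSchema.vars = S.toSchema.vars := by
  simp only [toSchema, Schema.vars, Set.union_empty]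
  refine subset_antisymm (Set.iUnion_subset fun k => ?_) fun x hx =>
    Set.mem_iUnion_of_mem (Fin.last i) (by simpa using hx)
  split_ifs
  · exact subset_rfl
  · exact Set.empty_subset _

theorem vars_toSchema_itemsAfter (n : ℕ) (S : Simple V) :
    (itemsAfter n S).toSchema.vars = S.toSchema.vars := by
  simp only [toSchema, Schema.vars, Set.iUnion_empty, Set.empty_union]

theorem vars_toSchema_bigAnd_subset {X : Set V} {l : List (Simple V)}
    (h : ∀ S ∈ l, S.toSchema.vars ⊆ X) : (bigAnd l).toSchema.vars ⊆ X := by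
  induction l with
  | nil => exact Set.empty_subset _
  | cons S l ih =>
    rw [List.forall_mem_cons] at h
    cases l with
    | nil => exact h.1
    | cons T l => exact Set.union_subset h.1 (ih h.2)

theorem vars_toSchema_bigOr_subset {X : Set V} {l : List (Simple V)}
    (h : ∀ S ∈ l, S.toSchema.vars ⊆ X) : (bigOr l).toSchema.vars ⊆ X := by
  induction l with
  | nil => exact Set.empty_subset _
  | cons S l ih =>
    rw [List.forall_mem_cons] at h
    cases l with
    | nil => exact h.1
    | cons T l => exact Set.union_subset h.1 (ih h.2)

theorem unguarded_toSchema_bigAnd_subset {X : Set V} {l : List (Simple V)}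
    (h : ∀ S ∈ l, S.toSchema.unguarded ⊆ X) : (bigAnd l).toSchema.unguarded ⊆ X := by
  induction l with
  | nil => exact Set.empty_subset _
  | cons S l ih =>
    rw [List.forall_mem_cons] at h
    cases l with
    | nil => exact h.1
    | cons T l => exact Set.union_subset h.1 (ih h.2)

theorem unguarded_toSchema_bigOr_subset {X : Set V} {l : List (Simple V)}
    (h : ∀ S ∈ l, S.toSchema.unguarded ⊆ X) : (bigOr l).toSchema.unguarded ⊆ X := by
  induction l with
  | nil => exact Set.empty_subset _
  | cons S l ih =>
    rw [List.forall_mem_cons] at h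
    cases l with
    | nil => exact h.1
    | cons T l => exact Set.union_subset h.1 (ih h.2)

theorem negFree_toSchema_bigAnd {l : List (Simple V)} (h : ∀ S ∈ l, S.toSchema.NegFree) :
    (bigAnd l).toSchema.NegFree := by
  induction l with
  | nil => trivial
  | cons S l ih =>
    rw [List.forall_mem_cons] at h
    cases l with
    | nil => exact h.1
    | cons T l => exact ⟨h.1, ih h.2⟩

theorem negFree_toSchema_bigOr {l : List (Simple V)} (h : ∀ S ∈ l, S.toSchema.NegFree) :
    (bigOr l).toSchema.NegFree := by
  induction l with
  | nil => trivial
  | cons S l ih =>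
    rw [List.forall_mem_cons] at h
    cases l with
    | nil => exact h.1
    | cons T l => exact ⟨h.1, ih h.2⟩

theorem vars_toSchema_ofConst (J : JSON) : (ofConst J : Simple V).toSchema.vars = ∅ := by
  rw [← Set.subset_empty_iff]
  induction J with
  | arr n f ih =>
    refine vars_toSchema_bigAnd_subset ?_
    simp only [List.forall_mem_append, List.forall_mem_cons, List.forall_mem_ofFn_iff,
      vars_toSchema_itemAt, ih, implies_true, and_true]
    simp [toSchema, Schema.vars]
  | obj ks f ih =>
    refine vars_toSchema_bigAnd_subset ?_
    simp only [List.forall_mem_append, List.forall_mem_cons, List.forall_mem_map,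
      vars_toSchema_props, vars_toSchema_pattReq, ih, implies_true, and_true]
    simp [toSchema, Schema.vars]
  | _ => simp [ofConst, toSchema, Schema.vars]

theorem vars_toSchema_bound_subset {op : ℕ → ℕ∞ → Simple V} {l : ℕ} {j : ℕ∞} :
    (bound op l j).toSchema.vars ⊆ (op l j).toSchema.vars := by
  rw [bound]
  split_ifs
  exacts [Set.empty_subset _, subset_rfl]

theorem vars_toSchema_realBound_subset {op : WithBot ℝ → WithTop ℝ → Simple V} {m : WithBot ℝ}
    {M : WithTop ℝ} : (realBound op m M).toSchema.vars ⊆ (op m M).toSchema.vars := by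
  rw [realBound]
  split_ifs
  exacts [Set.empty_subset _, subset_rfl]

end Simple

namespace Schema

variable {V : Type*} [DecidableEq V]

open Simple in
-- Equality can fail at `pNames`, whose variables are absorbed into a pattern.
theorem vars_toSchema_simplify_subset (E : List (V × Schema V)) (S : Schema V) :
    (S.simplify E).toSchema.vars ⊆ S.vars := by
  induction S with
  | type n T => exact vars_toSchema_bigOr_subset (List.forall_mem_ofFn_iff.2 fun _ => subset_rfl)
  | const J => exact (vars_toSchema_ofConst J).subset
  | enum n J => exact vars_toSchema_bigOr_subset (List.forall_mem_ofFn_iff.2 fun i =>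
      (vars_toSchema_ofConst (J i)).subset)
  | len l j => exact vars_toSchema_bound_subset
  | pro l j => exact vars_toSchema_bound_subset
  | ite l j => exact vars_toSchema_bound_subset
  | betw m M => exact vars_toSchema_realBound_subset
  | xBetw m M => exact vars_toSchema_realBound_subset
  | props n r S A ihS ihA =>
    refine vars_toSchema_bigAnd_subset ?_
    simp only [List.forall_mem_append, List.forall_mem_ofFn_iff, List.forall_mem_singleton,
      vars_toSchema_props]
    exact ⟨fun i => (ihS i).trans ((Set.subset_iUnion (fun i => (S i).vars) i).trans
      Set.subset_union_left), ihA.trans Set.subset_union_right⟩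
  | req n k =>
    refine vars_toSchema_bigAnd_subset ?_
    simp only [List.forall_mem_ofFn_iff, vars_toSchema_pattReq]
    exact fun _ => Set.empty_subset _
  | pNames S ih =>
    exact (vars_toSchema_props _ _).subset.trans (Set.empty_subset _)
  | items n S A ihS ihA =>
    refine vars_toSchema_bigAnd_subset ?_
    simp only [List.forall_mem_append, List.forall_mem_ofFn_iff, List.forall_mem_singleton,
      vars_toSchema_itemAt, vars_toSchema_itemsAfter]
    exact ⟨fun i => (ihS i).trans ((Set.subset_iUnion (fun i => (S i).vars) i).trans
      Set.subset_union_left), ihA.trans Set.subset_union_right⟩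
  | contains S ih => exact ih
  | contAfter n S ih => exact ih
  | pattReq n r S ih =>
    refine vars_toSchema_bigAnd_subset ?_
    simp only [List.forall_mem_ofFn_iff, vars_toSchema_pattReq]
    exact fun i => (ih i).trans (Set.subset_iUnion (fun i => (S i).vars) i)
  | neg S ih => exact ih
  | or S T ihS ihT => exact Set.union_subset_union ihS ihT
  | and S T ihS ihT => exact Set.union_subset_union ihS ihT
  | imp S T ihS ihT => exact Set.union_subset_union ihS ihT
  | cond S T U ihS ihT ihU =>
    refine Set.union_subset (Set.union_subset_union ihS ihT |>.trans Set.subset_union_left)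
      (Set.union_subset_union (ihS.trans Set.subset_union_left) ihU)
  | oneOf n S ih =>
    refine vars_toSchema_bigOr_subset (List.forall_mem_ofFn_iff.2 fun l =>
      vars_toSchema_bigAnd_subset (List.forall_mem_ofFn_iff.2 fun k => ?_))
    refine subset_trans ?_ ((ih k).trans (Set.subset_iUnion (fun i => (S i).vars) k))
    split_ifs
    exacts [subset_rfl, subset_rfl]
  | all n S ih =>
    exact vars_toSchema_bigAnd_subset (List.forall_mem_ofFn_iff.2 fun k =>
      (ih k).trans (Set.subset_iUnion (fun i => (S i).vars) k))
  | _ => exact subset_rfl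

open Simple in
-- Typed operators turn into conjunctions of typed operators, so their arguments stay guarded.
-- Guardedness of the simplified document rests on this.
theorem unguarded_toSchema_simplify_subset (E : List (V × Schema V)) (S : Schema V) :
    (S.simplify E).toSchema.unguarded ⊆ S.unguarded := by
  induction S with
  | neg S ih => exact ih
  | or S T ihS ihT => exact Set.union_subset_union ihS ihT
  | and S T ihS ihT => exact Set.union_subset_union ihS ihT
  | imp S T ihS ihT => exact Set.union_subset_union ihS ihT
  | cond S T U ihS ihT ihU =>
    refine Set.union_subset (Set.union_subset_union ihS ihT |>.trans Set.subset_union_left)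
      (Set.union_subset_union (ihS.trans Set.subset_union_left) ihU)
  | oneOf n S ih =>
    refine unguarded_toSchema_bigOr_subset (List.forall_mem_ofFn_iff.2 fun l =>
      unguarded_toSchema_bigAnd_subset (List.forall_mem_ofFn_iff.2 fun k => ?_))
    refine subset_trans ?_ ((ih k).trans (Set.subset_iUnion (fun i => (S i).unguarded) k))
    split_ifs
    exacts [subset_rfl, subset_rfl]
  | all n S ih =>
    exact unguarded_toSchema_bigAnd_subset (List.forall_mem_ofFn_iff.2 fun k =>
      (ih k).trans (Set.subset_iUnion (fun i => (S i).unguarded) k))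
  | var x => exact subset_rfl
  | type n T =>
    exact unguarded_toSchema_bigOr_subset (List.forall_mem_ofFn_iff.2 fun _ => subset_rfl)
  | props n r S A ihS ihA =>
    refine unguarded_toSchema_bigAnd_subset ?_
    simp only [List.forall_mem_append, List.forall_mem_ofFn_iff, List.forall_mem_singleton]
    exact ⟨fun _ => subset_rfl, subset_rfl⟩
  | items n S A ihS ihA =>
    refine unguarded_toSchema_bigAnd_subset ?_
    simp only [List.forall_mem_append, List.forall_mem_ofFn_iff, List.forall_mem_singleton]
    exact ⟨fun _ => subset_rfl, subset_rfl⟩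
  | pattReq n r S ih =>
    exact unguarded_toSchema_bigAnd_subset (List.forall_mem_ofFn_iff.2 fun _ => subset_rfl)
  | pNames S ih => exact subset_rfl
  | contains S ih => exact subset_rfl
  | contAfter n S ih => exact subset_rfl
  -- The remaining operators contain no variables.
  | _ => exact (unguarded_subset_vars _).trans (vars_toSchema_simplify_subset E _)

end Schema

namespace Simple

variable {V : Type*}

theorem vars_toSchema_otherTypes (T : JType) : (otherTypes T : Simple V).toSchema.vars = ∅ := by
  rw [← Set.subset_empty_iff]
  cases T <;>
    (refine vars_toSchema_bigOr_subset ?_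
     simp only [List.forall_mem_cons]
     exact ⟨subset_rfl, subset_rfl, subset_rfl, subset_rfl, subset_rfl, nofun⟩)

theorem vars_toSchema_outside {op : ℕ → ℕ∞ → Simple V}
    (h : ∀ l j, (op l j).toSchema.vars = ∅) (l : ℕ) (j : ℕ∞) :
    (outside op l j).toSchema.vars = ∅ := by
  rw [← Set.subset_empty_iff]
  refine vars_toSchema_bigOr_subset fun S hS => ?_
  rcases List.mem_append.1 hS with hS | hS <;> split_ifs at hS <;>
    first
    | exact absurd hS List.not_mem_nil
    | rw [List.mem_singleton.1 hS]; exact (h _ _).subset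

theorem vars_toSchema_realOutside {op : WithBot ℝ → WithTop ℝ → Simple V}
    (h : ∀ m M, (op m M).toSchema.vars = ∅) (m : WithBot ℝ) (M : WithTop ℝ) :
    (realOutside op m M).toSchema.vars = ∅ := by
  rw [← Set.subset_empty_iff]
  refine vars_toSchema_bigOr_subset fun S hS => ?_
  rcases List.mem_append.1 hS with hS | hS
  · cases m with
    | bot => exact absurd hS List.not_mem_nil
    | coe m => rw [List.mem_singleton.1 hS]; exact (h _ _).subset
  · cases M with
    | top => exact absurd hS List.not_mem_nil
    | coe M => rw [List.mem_singleton.1 hS]; exact (h _ _).subset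

/-- Pushing alters variables only through `co`; `X` will be the set of defined and complement
variables. -/
theorem vars_toSchema_push_subset (co : V → V) {X : Set V} (hX : Set.MapsTo co X X) (S : Simple V)
    (hS : S.toSchema.vars ⊆ X) :
    (push co S).toSchema.vars ⊆ X ∧ (pushNeg co S).toSchema.vars ⊆ X := by
  induction S with
  | type T => exact ⟨hS, (vars_toSchema_otherTypes T).trans_subset (Set.empty_subset _)⟩
  | bool b =>
    exact ⟨hS, Set.union_subset
      ((vars_toSchema_otherTypes _).trans_subset (Set.empty_subset _)) (Set.empty_subset _)⟩
  | len l j =>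
    exact ⟨hS, Set.union_subset (Set.empty_subset _)
      ((vars_toSchema_outside (fun _ _ => rfl) l j).trans_subset (Set.empty_subset _))⟩
  | pro l j =>
    exact ⟨hS, Set.union_subset (Set.empty_subset _)
      ((vars_toSchema_outside (fun _ _ => rfl) l j).trans_subset (Set.empty_subset _))⟩
  | ite l j =>
    exact ⟨hS, Set.union_subset (Set.empty_subset _)
      ((vars_toSchema_outside (fun _ _ => rfl) l j).trans_subset (Set.empty_subset _))⟩
  | betw m M =>
    exact ⟨hS, Set.union_subset (Set.empty_subset _)
      ((vars_toSchema_realOutside (fun _ _ => rfl) m M).trans_subset (Set.empty_subset _))⟩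
  | xBetw m M =>
    exact ⟨hS, Set.union_subset (Set.empty_subset _)
      ((vars_toSchema_realOutside (fun _ _ => rfl) m M).trans_subset (Set.empty_subset _))⟩
  | props r S ih =>
    rw [vars_toSchema_props] at hS
    rw [push, pushNeg, vars_toSchema_props]
    exact ⟨(ih hS).1, Set.union_subset (Set.empty_subset _)
      ((vars_toSchema_pattReq _ _).trans_subset (ih hS).2)⟩
  | pattReq r S ih =>
    rw [vars_toSchema_pattReq] at hS
    rw [push, pushNeg, vars_toSchema_pattReq]
    exact ⟨(ih hS).1, Set.union_subset (Set.empty_subset _)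
      ((vars_toSchema_props _ _).trans_subset (ih hS).2)⟩
  | itemAt i S ih =>
    rw [vars_toSchema_itemAt] at hS
    rw [push, pushNeg, vars_toSchema_itemAt]
    refine ⟨(ih hS).1, vars_toSchema_bigAnd_subset ?_⟩
    simp only [List.forall_mem_cons, vars_toSchema_itemAt]
    exact ⟨Set.empty_subset _, (ih hS).2, Set.empty_subset _, nofun⟩
  | itemsAfter n S ih =>
    rw [vars_toSchema_itemsAfter] at hS
    rw [push, pushNeg, vars_toSchema_itemsAfter]
    exact ⟨(ih hS).1, Set.union_subset (Set.empty_subset _) (ih hS).2⟩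
  | contAfter n S ih =>
    exact ⟨(ih hS).1, Set.union_subset (Set.empty_subset _)
      ((vars_toSchema_itemsAfter _ _).trans_subset (ih hS).2)⟩
  | var x => exact ⟨hS, Set.singleton_subset_iff.2 (hX (hS rfl))⟩
  | neg S ih => exact (ih hS).symm
  | and S T ihS ihT =>
    obtain ⟨h₁, h₂⟩ := Set.union_subset_iff.1 hS
    exact ⟨Set.union_subset (ihS h₁).1 (ihT h₂).1, Set.union_subset (ihS h₁).2 (ihT h₂).2⟩
  | or S T ihS ihT =>
    obtain ⟨h₁, h₂⟩ := Set.union_subset_iff.1 hS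
    exact ⟨Set.union_subset (ihS h₁).1 (ihT h₂).1, Set.union_subset (ihS h₁).2 (ihT h₂).2⟩
  | tt => exact ⟨hS, Set.empty_subset _⟩
  | ff => exact ⟨hS, Set.empty_subset _⟩
  | _ => exact ⟨hS, Set.union_subset (Set.empty_subset _) (Set.empty_subset _)⟩

/-- An occurrence meets `co` at most once, so `co` need only map `X` into `Y`. In the application
`Y` collects the variables with the same base as some unguarded variable of `S`. -/
theorem unguarded_toSchema_push_subset (co : V → V) {X Y : Set V} (hXY : X ⊆ Y)
    (hX : Set.MapsTo co X Y) (S : Simple V) (hS : S.toSchema.unguarded ⊆ X) :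
    (push co S).toSchema.unguarded ⊆ Y ∧ (pushNeg co S).toSchema.unguarded ⊆ Y := by
  -- Pushing introduces no variables into a schema that has none.
  have closed : ∀ S : Simple V, S.toSchema.vars ⊆ ∅ →
      (push co S).toSchema.unguarded ⊆ Y ∧ (pushNeg co S).toSchema.unguarded ⊆ Y := fun S hS => by
    obtain ⟨h₁, h₂⟩ := vars_toSchema_push_subset co (Set.mapsTo_empty co ∅) S hS
    exact ⟨((Schema.unguarded_subset_vars _).trans h₁).trans (Set.empty_subset _),
      ((Schema.unguarded_subset_vars _).trans h₂).trans (Set.empty_subset _)⟩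
  induction S with
  | var x => exact ⟨hS.trans hXY, Set.singleton_subset_iff.2 (hX (hS rfl))⟩
  | neg S ih => exact (ih hS).symm
  | and S T ihS ihT =>
    obtain ⟨h₁, h₂⟩ := Set.union_subset_iff.1 hS
    exact ⟨Set.union_subset (ihS h₁).1 (ihT h₂).1, Set.union_subset (ihS h₁).2 (ihT h₂).2⟩
  | or S T ihS ihT =>
    obtain ⟨h₁, h₂⟩ := Set.union_subset_iff.1 hS
    exact ⟨Set.union_subset (ihS h₁).1 (ihT h₂).1, Set.union_subset (ihS h₁).2 (ihT h₂).2⟩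
  | props r S ih =>
    exact ⟨Set.empty_subset _, Set.union_subset (Set.empty_subset _) (Set.empty_subset _)⟩
  | pattReq r S ih =>
    exact ⟨Set.empty_subset _, Set.union_subset (Set.empty_subset _) (Set.empty_subset _)⟩
  | itemAt i S ih =>
    refine ⟨Set.empty_subset _, unguarded_toSchema_bigAnd_subset ?_⟩
    simp only [List.forall_mem_cons]
    exact ⟨Set.empty_subset _, Set.empty_subset _, Set.empty_subset _, nofun⟩
  | itemsAfter n S ih =>
    exact ⟨Set.empty_subset _, Set.union_subset (Set.empty_subset _) (Set.empty_subset _)⟩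
  | contAfter n S ih =>
    exact ⟨Set.empty_subset _, Set.union_subset (Set.empty_subset _) (Set.empty_subset _)⟩
  | _ => exact closed _ subset_rfl

theorem negFree_toSchema_outside {op : ℕ → ℕ∞ → Simple V}
    (h : ∀ l j, (op l j).toSchema.NegFree) (l : ℕ) (j : ℕ∞) :
    (outside op l j).toSchema.NegFree := by
  refine negFree_toSchema_bigOr fun S hS => ?_
  rcases List.mem_append.1 hS with hS | hS <;> split_ifs at hS <;>
    first
    | exact absurd hS List.not_mem_nil
    | rw [List.mem_singleton.1 hS]; exact h _ _

theorem negFree_toSchema_realOutside {op : WithBot ℝ → WithTop ℝ → Simple V}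
    (h : ∀ m M, (op m M).toSchema.NegFree) (m : WithBot ℝ) (M : WithTop ℝ) :
    (realOutside op m M).toSchema.NegFree := by
  refine negFree_toSchema_bigOr fun S hS => ?_
  rcases List.mem_append.1 hS with hS | hS
  · cases m with
    | bot => exact absurd hS List.not_mem_nil
    | coe m => rw [List.mem_singleton.1 hS]; exact h _ _
  · cases M with
    | top => exact absurd hS List.not_mem_nil
    | coe M => rw [List.mem_singleton.1 hS]; exact h _ _

theorem negFree_toSchema_otherTypes (T : JType) : (otherTypes T : Simple V).toSchema.NegFree := by
  cases T <;>
    (refine negFree_toSchema_bigOr ?_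
     simp only [List.forall_mem_cons]
     exact ⟨trivial, trivial, trivial, trivial, trivial, nofun⟩)

theorem negFree_toSchema_itemAt {i : ℕ} {S : Simple V} (h : S.toSchema.NegFree) :
    (itemAt i S).toSchema.NegFree := by
  refine ⟨fun k => ?_, trivial⟩
  dsimp only
  split_ifs
  exacts [h, trivial]

theorem negFree_toSchema_push (co : V → V) (S : Simple V) :
    (push co S).toSchema.NegFree ∧ (pushNeg co S).toSchema.NegFree := by
  induction S with
  | type T => exact ⟨trivial, negFree_toSchema_otherTypes T⟩
  | bool b => exact ⟨trivial, negFree_toSchema_otherTypes _, trivial⟩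
  | len l j =>
    exact ⟨trivial, trivial, negFree_toSchema_outside (op := len) (fun _ _ => trivial) l j⟩
  | pro l j =>
    exact ⟨trivial, trivial, negFree_toSchema_outside (op := pro) (fun _ _ => trivial) l j⟩
  | ite l j =>
    exact ⟨trivial, trivial, negFree_toSchema_outside (op := ite) (fun _ _ => trivial) l j⟩
  | betw m M =>
    exact ⟨trivial, trivial, negFree_toSchema_realOutside (op := xBetw) (fun _ _ => trivial) m M⟩
  | xBetw m M =>
    exact ⟨trivial, trivial, negFree_toSchema_realOutside (op := betw) (fun _ _ => trivial) m M⟩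
  | props r S ih => exact ⟨⟨fun _ => ih.1, trivial⟩, trivial, fun _ => ih.2⟩
  | pattReq r S ih => exact ⟨fun _ => ih.1, trivial, fun _ => ih.2, trivial⟩
  | itemAt i S ih =>
    refine ⟨negFree_toSchema_itemAt ih.1, negFree_toSchema_bigAnd ?_⟩
    simp only [List.forall_mem_cons]
    exact ⟨trivial, negFree_toSchema_itemAt ih.2, trivial, nofun⟩
  | itemsAfter n S ih => exact ⟨⟨fun _ => trivial, ih.1⟩, trivial, ih.2⟩
  | contAfter n S ih => exact ⟨ih.1, trivial, fun _ => trivial, ih.2⟩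
  | var x => exact ⟨trivial, trivial⟩
  | tt => exact ⟨trivial, trivial⟩
  | ff => exact ⟨trivial, trivial⟩
  | neg S ih => exact ih.symm
  | and S T ihS ihT => exact ⟨⟨ihS.1, ihT.1⟩, ihS.2, ihT.2⟩
  | or S T ihS ihT => exact ⟨⟨ihS.1, ihT.1⟩, ihS.2, ihT.2⟩
  | _ => exact ⟨trivial, trivial, trivial⟩

end Simple

-- Names and complement variables.

namespace Doc

variable {V σ τ : Type*}

theorem names_mapBodies (f : σ → τ) (D : Doc V σ) : (D.mapBodies f).names = D.names := by
  simp only [names, mapBodies, List.map_map]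
  rfl

theorem names_notCompletion (neg : σ → σ) (not_ : V → V) (D : Doc V σ) :
    (D.notCompletion neg not_).names = D.names ++ D.names.map not_ := by
  simp only [names, notCompletion, List.map_append, List.map_map]
  rfl

theorem mem_names_of_mem_env {D : Doc V σ} {p : V × σ} (h : p ∈ D.env) : p.1 ∈ D.names :=
  List.mem_map_of_mem h

variable [DecidableEq V] {D : Doc V σ} {not_ : V → V}

theorem Fresh.complement_of_mem (h : D.Fresh not_) {x : V} (hx : x ∈ D.names) :
    complement not_ D.names x = not_ x := by
  have : D.names.find? (fun y => not_ y = x) = none :=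
    List.find?_eq_none.2 fun y hy hyx => h.2 y hy (of_decide_eq_true hyx ▸ hx)
  rw [complement, this]

theorem Fresh.complement_not (h : D.Fresh not_) {x : V} (hx : x ∈ D.names) :
    complement not_ D.names (not_ x) = x := by
  rw [complement]
  cases hy : D.names.find? (fun y => not_ y = not_ x) with
  | none => exact absurd (decide_eq_true rfl) (List.find?_eq_none.1 hy x hx)
  | some y =>
    exact h.1 y (List.mem_of_find?_eq_some hy) x hx
      (of_decide_eq_true (List.find?_some (p := fun y => decide (not_ y = not_ x)) hy))

theorem Fresh.mapsTo_complement (h : D.Fresh not_) {x : V}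
    (hx : x ∈ D.names ++ D.names.map not_) :
    complement not_ D.names x ∈ D.names ++ D.names.map not_ := by
  rcases List.mem_append.1 hx with hx | hx
  · rw [h.complement_of_mem hx]
    exact List.mem_append_right _ (List.mem_map_of_mem hx)
  · obtain ⟨y, hy, rfl⟩ := List.mem_map.1 hx
    rw [h.complement_not hy]
    exact List.mem_append_left _ hy

/-- The defined variable to which a variable of the not-completion belongs. -/
def base (not_ : V → V) (xs : List V) (x : V) : V :=
  if x ∈ xs then x else complement not_ xs x

theorem base_of_mem {xs : List V} {x : V} (hx : x ∈ xs) : base not_ xs x = x := if_pos hx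

theorem Fresh.base_not (h : D.Fresh not_) {x : V} (hx : x ∈ D.names) :
    base not_ D.names (not_ x) = x :=
  (if_neg (h.2 x hx)).trans (h.complement_not hx)

/-- `complement` swaps `x` and `not_ x`, and `base` forgets which of the two it sees; replacing a
variable by its complement is thus invisible to dependencies between bases. -/
theorem Fresh.base_complement (h : D.Fresh not_) {x : V}
    (hx : x ∈ D.names ++ D.names.map not_) :
    base not_ D.names (complement not_ D.names x) = base not_ D.names x := by
  rcases List.mem_append.1 hx with hx | hx
  · rw [h.complement_of_mem hx, h.base_not hx, base_of_mem hx]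
  · obtain ⟨y, hy, rfl⟩ := List.mem_map.1 hx
    rw [h.complement_not hy, h.base_not hy, base_of_mem hy]

end Doc

-- Not-completion and simplification of documents.

namespace Document

variable {V : Type*} [DecidableEq V] {D D' : Document V} {not_ : V → V} {ρ : V → Set JSON}

theorem depends_iff (h : D.names.Nodup) {x y : V} :
    D.Depends x y ↔ ∃ S, (x, S) ∈ D.env ∧ y ∈ S.unguarded :=
  exists_congr fun _ => and_congr_left fun _ =>
    ⟨List.mem_of_lookup_eq_some, List.lookup_eq_some_of_mem h⟩

theorem solves_iff (h : D.names.Nodup) :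
    Schema.Solves ρ D.env ↔ ∀ p ∈ D.env, ρ p.1 = p.2.eval ρ :=
  ⟨fun H p hp => H p.1 p.2 (List.lookup_eq_some_of_mem h hp),
    fun H x S hS => H (x, S) (List.mem_of_lookup_eq_some hS)⟩

/-- A cycle is mapped to a cycle, even when `b` is not injective. -/
theorem Guarded.of_map (hD : D.Guarded) (b : V → V)
    (h : ∀ x y, D'.Depends x y → D.Depends (b x) (b y)) : D'.Guarded :=
  fun x hx => hD (b x) (hx.lift b h)

theorem WellFormed.sem_eq_eval (hD : D.WellFormed) (hρ : Schema.Solves ρ D.env) :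
    D.sem = D.root.eval ρ :=
  Document.sem_eq_eval hD.2.1 hD.2.2 hρ hD.2.1.1

theorem WellFormed.exists_solves (hD : D.WellFormed) : ∃ ρ, Schema.Solves ρ D.env :=
  Document.exists_solves hD.2.1 hD.2.2

/-- A change of the bodies that keeps the meanings of all bodies keeps the semantics. -/
theorem WellFormed.sem_mapBodies (hD : D.WellFormed) {σ : Type*} {f g : σ → Schema V}
    {D₀ : Doc V σ} (hf : D = D₀.mapBodies f) (hD' : Document.WellFormed (D₀.mapBodies g))
    (hρ : Schema.Solves ρ D.env) (hroot : (g D₀.root).eval ρ = (f D₀.root).eval ρ)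
    (henv : ∀ p ∈ D₀.env, (g p.2).eval ρ = (f p.2).eval ρ) :
    Document.sem (D₀.mapBodies g) = D.sem := by
  subst hf
  -- Bodies with equal meanings under `ρ` make `ρ` a common solution, and a common solution
  -- determines both semantics.
  have hρ' : Schema.Solves ρ (D₀.mapBodies g).env := by
    rw [solves_iff hD.1] at hρ
    refine (solves_iff hD'.1).2 (List.forall_mem_map.2 fun p hp => ?_)
    exact (hρ (p.1, f p.2) (List.mem_map_of_mem hp)).trans (henv p hp).symm
  rw [hD.sem_eq_eval hρ, hD'.sem_eq_eval hρ']
  exact hroot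

section NotCompletion

theorem mem_env_notCompletion {V : Type*} {D : Document V} {not_ : V → V}
    {p : V × Schema V} :
    p ∈ (notCompletion not_ D).env ↔ p ∈ D.env ∨ ∃ q ∈ D.env, (not_ q.1, .neg q.2) = p :=
  List.mem_append.trans (or_congr Iff.rfl List.mem_map)

theorem nodup_names_notCompletion {V : Type*} {D : Document V} {not_ : V → V}
    (hD : D.names.Nodup) (hf : D.Fresh not_) :
    (notCompletion not_ D).names.Nodup := by
  rw [notCompletion, Doc.names_notCompletion]
  refine List.Nodup.append hD (List.Nodup.map_on hf.1 hD) fun x hx hx' => ?_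
  obtain ⟨y, hy, rfl⟩ := List.mem_map.1 hx'
  exact hf.2 y hy hx

/-- The body of `not_ x` is the negated body of `x`, with the same unguarded variables. -/
theorem depends_base_of_notCompletion (hD : D.WellFormed) (hf : D.Fresh not_) {x y : V}
    (h : (notCompletion not_ D).Depends x y) :
    D.Depends (Doc.base not_ D.names x) (Doc.base not_ D.names y) := by
  obtain ⟨S, hS, hy⟩ := (depends_iff (nodup_names_notCompletion hD.1 hf)).1 h
  refine (depends_iff hD.1).2 ?_
  rcases mem_env_notCompletion.1 hS with hS | ⟨⟨z, T⟩, hT, hS⟩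
  · rw [Doc.base_of_mem (Doc.mem_names_of_mem_env hS),
      Doc.base_of_mem (hD.2.1.2 _ hS _ (S.unguarded_subset_vars hy))]
    exact ⟨S, hS, hy⟩
  · cases hS
    rw [hf.base_not (Doc.mem_names_of_mem_env hT),
      Doc.base_of_mem (hD.2.1.2 _ hT _ (T.unguarded_subset_vars hy))]
    exact ⟨T, hT, hy⟩

theorem WellFormed.notCompletion (hD : D.WellFormed) (hf : D.Fresh not_) :
    (notCompletion not_ D).WellFormed := by
  refine ⟨nodup_names_notCompletion hD.1 hf, ⟨fun x hx => ?_, fun p hp x hx => ?_⟩,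
    hD.2.2.of_map _ fun x y => depends_base_of_notCompletion hD hf⟩ <;>
    refine (Doc.names_notCompletion _ _ D).symm ▸ List.mem_append_left _ ?_
  · exact hD.2.1.1 x hx
  · rcases mem_env_notCompletion.1 hp with hp | ⟨q, hq, rfl⟩
    · exact hD.2.1.2 p hp x hx
    · exact hD.2.1.2 q hq x hx

/-- The larger environment contains the old equations, and its equation for `not_ x` complements the
one for `x`. Restricting a solution in this way avoids having to extend one. -/
theorem Solves.of_notCompletion (hD : D.WellFormed) (hf : D.Fresh not_)
    (hρ : Schema.Solves ρ (notCompletion not_ D).env) :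
    Schema.Solves ρ D.env ∧ ∀ x ∈ D.names, ρ (not_ x) = (ρ x)ᶜ := by
  rw [solves_iff (nodup_names_notCompletion hD.1 hf)] at hρ
  have h : ∀ p ∈ D.env, ρ p.1 = p.2.eval ρ := fun p hp =>
    hρ p (mem_env_notCompletion.2 (.inl hp))
  refine ⟨(solves_iff hD.1).2 h, List.forall_mem_map.2 fun p hp => ?_⟩
  rw [h p hp]
  exact hρ _ (mem_env_notCompletion.2 (.inr ⟨p, hp, rfl⟩))

theorem WellFormed.sem_notCompletion (hD : D.WellFormed) (hf : D.Fresh not_) :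
    (Document.notCompletion not_ D).sem = D.sem := by
  have hD' := hD.notCompletion hf
  obtain ⟨ρ, hρ⟩ := hD'.exists_solves
  rw [hD'.sem_eq_eval hρ, hD.sem_eq_eval (Solves.of_notCompletion hD hf hρ).1]
  rfl

theorem WellFormed.sem_neg_var (hD : D.WellFormed) (hf : D.Fresh not_) {x : V}
    (hx : x ∈ D.names) :
    (Schema.neg (.var x)).sem D.env =
      (Schema.var (not_ x)).sem (Document.notCompletion not_ D).env := by
  have hD' := hD.notCompletion hf
  obtain ⟨ρ, hρ⟩ := hD'.exists_solves
  obtain ⟨hρD, hnot⟩ := Solves.of_notCompletion hD hf hρ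
  rw [Document.sem_eq_eval hD.2.1 hD.2.2 hρD, Document.sem_eq_eval hD'.2.1 hD'.2.2 hρ]
  · exact (hnot x hx).symm
  · rintro _ rfl
    rw [Document.notCompletion, Doc.names_notCompletion]
    exact List.mem_append_right _ (List.mem_map_of_mem hx)
  · rintro _ rfl
    exact hx

end NotCompletion

section Simplify

theorem names_toDocument_simplify (D : Document V) : D.simplify.toDocument.names = D.names :=
  (Doc.names_mapBodies _ _).trans (Doc.names_mapBodies _ _)

theorem toDocument_simplify (D : Document V) :
    D.simplify.toDocument = D.mapBodies fun S => (S.simplify D.env).toSchema := by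
  simp only [simplify, Doc.toDocument, Doc.mapBodies, List.map_map]
  rfl

theorem WellFormed.simplify (hD : D.WellFormed) : D.simplify.toDocument.WellFormed := by
  have hn : D.simplify.toDocument.names.Nodup := D.names_toDocument_simplify ▸ hD.1
  refine ⟨hn, ⟨fun x hx => ?_, fun p hp x hx => ?_⟩, hD.2.2.of_map id fun x y h => ?_⟩
  · rw [names_toDocument_simplify]
    exact hD.2.1.1 x (Schema.vars_toSchema_simplify_subset _ _ hx)
  · rw [names_toDocument_simplify]
    rw [toDocument_simplify] at hp
    obtain ⟨q, hq, rfl⟩ := List.mem_map.1 hp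
    exact hD.2.1.2 q hq x (Schema.vars_toSchema_simplify_subset _ _ hx)
  · obtain ⟨S, hS, hy⟩ := (depends_iff hn).1 h
    rw [toDocument_simplify] at hS
    obtain ⟨⟨z, T⟩, hT, hS⟩ := List.mem_map.1 hS
    cases hS
    exact (depends_iff hD.1).2 ⟨T, hT, Schema.unguarded_toSchema_simplify_subset _ _ hy⟩

theorem WellFormed.sem_simplify (hD : D.WellFormed) : D.simplify.toDocument.sem = D.sem := by
  obtain ⟨ρ, hρ⟩ := hD.exists_solves
  have hD' := hD.simplify
  rw [toDocument_simplify] at hD' ⊢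
  have hid : D = D.mapBodies id := by simp [Doc.mapBodies]
  exact hD.sem_mapBodies hid hD' hρ
    (Schema.eval_toSchema_simplify hD.2.1 hD.2.2 hρ _ hD.2.1.1)
    fun p hp => Schema.eval_toSchema_simplify hD.2.1 hD.2.2 hρ _ (hD.2.1.2 p hp)

end Simplify

end Document

-- Not-pushing on documents, and fresh names.

namespace Doc

variable {V : Type*} [DecidableEq V] {D : Doc V (Simple V)} {not_ : V → V}

theorem names_toDocument {V : Type*} (D : Doc V (Simple V)) : D.toDocument.names = D.names :=
  names_mapBodies _ _

/-- Transfers the results on not-completion in the closed algebra to simplified documents. -/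
theorem toDocument_notCompletion {V : Type*} (not_ : V → V) (D : Doc V (Simple V)) :
    (D.notCompletion .neg not_).toDocument = Document.notCompletion not_ D.toDocument := by
  simp only [Document.notCompletion, Doc.notCompletion, Doc.toDocument, Doc.mapBodies,
    List.map_append, List.map_map]
  rfl

theorem toDocument_push (not_ : V → V) (xs : List V) (D : Doc V (Simple V)) :
    (D.push not_ xs).toDocument =
      D.mapBodies fun S => (S.push (complement not_ xs)).toSchema := by
  simp only [Doc.push, Doc.toDocument, Doc.mapBodies, List.map_map]
  rfl

theorem Fresh.toDocument {V : Type*} {D : Doc V (Simple V)} {not_ : V → V}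
    (h : D.Fresh not_) : D.toDocument.Fresh not_ := by
  rwa [Fresh, names_toDocument]

/-- The set of defined names is closed under `complement`, so no undefined variable appears; `base`
maps a dependency cycle after pushing to one in `D`. -/
theorem wellFormed_push (hD : D.toDocument.WellFormed) (hf : D.Fresh not_) :
    ((D.notCompletion .neg not_).push not_ D.names).toDocument.WellFormed := by
  have hD₁ := hD.notCompletion hf.toDocument
  have hdep := fun x y => Document.depends_base_of_notCompletion hD hf.toDocument (x := x) (y := y)
  rw [← toDocument_notCompletion] at hD₁ hdep
  rw [names_toDocument] at hdep
  have hnames : (D.notCompletion .neg not_).toDocument.names = D.names ++ D.names.map not_ :=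
    (names_toDocument _).trans (names_notCompletion _ _ _)
  have hnames' : ((D.notCompletion .neg not_).push not_ D.names).toDocument.names =
      D.names ++ D.names.map not_ :=
    (names_toDocument _).trans ((names_mapBodies _ _).trans (names_notCompletion _ _ _))
  have hn : ((D.notCompletion .neg not_).push not_ D.names).toDocument.names.Nodup := by
    rw [hnames', ← hnames]
    exact hD₁.1
  have hco : Set.MapsTo (complement not_ D.names) {x | x ∈ D.names ++ D.names.map not_}
      {x | x ∈ D.names ++ D.names.map not_} := fun x => hf.mapsTo_complement
  have hclosed : ∀ p ∈ (D.notCompletion .neg not_).env, p.2.toSchema.vars ⊆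
      {x | x ∈ D.names ++ D.names.map not_} := fun p hp x hx =>
    hnames ▸ hD₁.2.1.2 _ (List.mem_map_of_mem hp) x hx
  refine ⟨hn, ⟨fun x hx => ?_, fun p hp x hx => ?_⟩, hD.2.2.of_map (base not_ D.names)
    fun x y h => ?_⟩
  · rw [hnames']
    exact (Simple.vars_toSchema_push_subset _ hco _ fun y hy => hnames ▸ hD₁.2.1.1 y hy).1 hx
  · rw [hnames']
    rw [toDocument_push] at hp
    obtain ⟨q, hq, rfl⟩ := List.mem_map.1 hp
    exact (Simple.vars_toSchema_push_subset _ hco _ (hclosed q hq)).1 hx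
  · obtain ⟨S, hS, hy⟩ := (Document.depends_iff hn).1 h
    rw [toDocument_push] at hS
    obtain ⟨⟨z, T⟩, hT, hS⟩ := List.mem_map.1 hS
    cases hS
    -- An unguarded variable of the pushed body was unguarded before, or is the complement of one
    -- that was; its base is the same either way.
    have hbase : ∃ w ∈ T.toSchema.unguarded, base not_ D.names y = base not_ D.names w :=
      (Simple.unguarded_toSchema_push_subset (complement not_ D.names)
        (Y := {y | ∃ w ∈ T.toSchema.unguarded, base not_ D.names y = base not_ D.names w})
        (fun w hw => ⟨w, hw, rfl⟩)
        (fun w hw => ⟨w, hw, hf.base_complement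
          (hclosed _ hT (Schema.unguarded_subset_vars _ hw))⟩) T subset_rfl).1 hy
    obtain ⟨w, hw, hyw⟩ := hbase
    rw [hyw]
    exact hdep _ _ ((Document.depends_iff hD₁.1).2 ⟨_, List.mem_map_of_mem hT, hw⟩)

/-- A solution of the not-completion interprets `complement` as set complement on old and new names
alike, which is what `Simple.eval_push` requires. -/
theorem sem_push (hD : D.toDocument.WellFormed) (hf : D.Fresh not_) :
    ((D.notCompletion .neg not_).push not_ D.names).toDocument.sem = D.toDocument.sem := by
  have hD₁ := hD.notCompletion hf.toDocument
  have hD₂ := wellFormed_push hD hf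
  rw [← hD.sem_notCompletion hf.toDocument]
  obtain ⟨ρ, hρ⟩ := hD₁.exists_solves
  have hnot := (Document.Solves.of_notCompletion hD hf.toDocument hρ).2
  rw [names_toDocument] at hnot
  have hco : ∀ x ∈ D.names ++ D.names.map not_, ρ (complement not_ D.names x) = (ρ x)ᶜ := by
    intro x hx
    rcases List.mem_append.1 hx with hx | hx
    · rw [hf.complement_of_mem hx, hnot x hx]
    · obtain ⟨y, hy, rfl⟩ := List.mem_map.1 hx
      rw [hf.complement_not hy, hnot y hy, compl_compl]
  rw [← toDocument_notCompletion] at hD₁ hρ ⊢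
  have hnames : (D.notCompletion .neg not_).toDocument.names = D.names ++ D.names.map not_ :=
    (names_toDocument _).trans (names_notCompletion _ _ _)
  rw [toDocument_push] at hD₂ ⊢
  exact hD₁.sem_mapBodies rfl hD₂ hρ
    (Simple.eval_push _ _ fun x hx => hco x (hnames ▸ hD₁.2.1.1 x hx)).1
    fun p hp => (Simple.eval_push _ _ fun x hx =>
      hco x (hnames ▸ hD₁.2.1.2 _ (List.mem_map_of_mem hp) x hx)).1

theorem negFree_push (not_ : V → V) (xs : List V) (D : Doc V (Simple V)) :
    (D.push not_ xs).toDocument.NegFree := by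
  rw [toDocument_push]
  exact ⟨(Simple.negFree_toSchema_push _ _).1,
    List.forall_mem_map.2 fun p _ => (Simple.negFree_toSchema_push _ _).1⟩

/-- Infinitely many names are unused; the defined variable at position `k` of the list is sent to
the `k`-th term of an injective sequence of them. -/
theorem exists_fresh {V σ : Type*} [DecidableEq V] [Infinite V] (D : Doc V σ) :
    ∃ not_ : V → V, D.Fresh not_ := by
  have : Infinite {x // x ∉ D.names.toFinset} :=
    (Finset.finite_toSet D.names.toFinset).infinite_compl.to_subtype
  let f := Infinite.natEmbedding {x // x ∉ D.names.toFinset}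
  refine ⟨fun x => f (D.names.idxOf x), fun x hx y hy h => ?_, fun x _ h => ?_⟩
  · exact (List.idxOf_inj hx).1 (f.injective (Subtype.ext h))
  · exact (f (D.names.idxOf x)).2 (List.mem_toFinset.2 h)

end Doc

-- The whole not-elimination procedure.

namespace Document

variable {V : Type*} [DecidableEq V] {D : Document V} {not_ : V → V}

theorem fresh_simplify (hf : D.Fresh not_) : D.simplify.Fresh not_ := by
  rwa [Doc.Fresh, simplify, Doc.names_mapBodies]

theorem notElimination_eq (not_ : V → V) (D : Document V) : D.notElimination not_ =
    ((D.simplify.notCompletion .neg not_).push not_ D.simplify.names).toDocument := by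
  rw [notElimination, simplify, Doc.names_mapBodies]

theorem WellFormed.notElimination (hD : D.WellFormed) (hf : D.Fresh not_) :
    (D.notElimination not_).WellFormed :=
  notElimination_eq not_ D ▸ Doc.wellFormed_push hD.simplify (fresh_simplify hf)

theorem WellFormed.sem_notElimination (hD : D.WellFormed) (hf : D.Fresh not_) :
    (D.notElimination not_).sem = D.sem := by
  rw [notElimination_eq, Doc.sem_push hD.simplify (fresh_simplify hf), hD.sem_simplify]

theorem negFree_notElimination (not_ : V → V) (D : Document V) :
    (D.notElimination not_).NegFree :=
  Doc.negFree_push _ _ _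

end Document

theorem mainTheorem1 {V : Type*} [DecidableEq V] :
    (∀ (D : Document V) (not_ : V → V), D.WellFormed → D.Fresh not_ →
      -- not-completion keeps the document well formed, and gives complement variables
      (Document.notCompletion not_ D).WellFormed ∧
      (Document.notCompletion not_ D).sem = D.sem ∧
      (∀ x ∈ D.names, (Schema.neg (.var x)).sem D.env =
        (Schema.var (not_ x)).sem (Document.notCompletion not_ D).env) ∧
      -- the successive phases of not-elimination preserve the semantics
      D.simplify.toDocument.sem = D.sem ∧
      (D.simplify.notCompletion .neg not_).toDocument.sem = D.sem ∧
      (D.notElimination not_).sem = D.sem ∧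
      -- the result is a well-formed document without negation
      (D.notElimination not_).WellFormed ∧
      (D.notElimination not_).NegFree) ∧
    -- with an infinite supply of names, the closed algebra is negation-closed
    (Infinite V → ∀ D : Document V, D.WellFormed →
      ∃ D' : Document V, D'.WellFormed ∧ D'.NegFree ∧ D'.sem = D.sem) := by
  refine ⟨fun D not_ hD hf => ⟨hD.notCompletion hf, hD.sem_notCompletion hf,
    fun x hx => hD.sem_neg_var hf hx, hD.sem_simplify, ?_, hD.sem_notElimination hf,
    hD.notElimination hf, D.negFree_notElimination not_⟩, fun _ D hD => ?_⟩
  · rw [Doc.toDocument_notCompletion,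
      hD.simplify.sem_notCompletion (Document.fresh_simplify hf).toDocument, hD.sem_simplify]
  · obtain ⟨not_, hf⟩ := D.exists_fresh
    exact ⟨D.notElimination not_, hD.notElimination hf, D.negFree_notElimination not_,
      hD.sem_notElimination hf⟩
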